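/- Let $\Gamma$ be a finite group with $|\Gamma|>2$ and let $X=X^{-1}\subseteq\Gamma\setminus\{1\}$ be a generating set. Let $G=\mathrm{Cay}(\Gamma,X)$ be the (right-invariant) Cayley graph: its vertices are the elements of $\Gamma$, and $g,h$ are adjacent iff $hg^{-1}\in X$. Suppose that $G$ is a graphical regular representation of $\Gamma$, that is, every automorphism of $G$ is a translation $g\mapsto ga$ with $a\in\Gamma$. (For every finite non-solvable group $\Gamma$ such a set $X$ exists by a theorem of Godsil.) Fix any orientation of the edges of $G$, with tails $e^-$ and heads $e^+$, and let $E$ be the edge set. For $\mathbb{K}\in\{\mathbb{R},\mathbb{C}\}$ let $D:\mathbb{K}^E\to\mathbb{K}^\Gamma$, $(DF)(v)=\sum_{e^+=v}F(e)-\sum_{e^-=v}F(e)$, be the incidence operator, let $Z_{\mathbb{K}}(G)=\ker D$ be the cycle space and $B_{\mathbb{K}}(G)=Z_{\mathbb{K}}(G)^\perp\subseteq\mathbb{K}^E$ the cut space; write $Z(G)=Z_{\mathbb{R}}(G)$ and $B(G)=B_{\mathbb{R}}(G)$. Let $\mathrm{Cy}(G)$ be the group of all linear isometries of $\ell_1(E)=(\mathbb{R}^E,\|\cdot\|_1)$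 that map $Z(G)$ onto itself; a linear projection $P$ of $\ell_1(E)$ onto $Z(G)$ is called invariant if $P\omega=\omega P$ for all $\omega\in\mathrm{Cy}(G)$. The group $\Gamma$ acts on $\mathbb{K}^E$ through the translations $g\mapsto ga^{-1}$ ($a\in\Gamma$), which permute the oriented edges (reversing an edge changes the sign of its unit vector), and this action preserves $Z_{\mathbb{K}}(G)$ and $B_{\mathbb{K}}(G)$. Then: 1. The invariant projection onto $Z(G)$ is not unique: there are two different invariant projections of $\ell_1(E)$ onto $Z(G)$. 2. For $\mathbb{K}=\mathbb{R}$ and for $\mathbb{K}=\mathbb{C}$, an irreducible representation of $\Gamma$ over $\mathbb{K}$ is equivalent to a subrepresentation of $B_{\mathbb{K}}(G)$ if and only if it is not the trivial representation. 3. For $\mathbb{K}=\mathbb{R}$ and for $\mathbb{K}=\mathbb{C}$, the representation of $\Gamma$ on $Z_{\mathbb{K}}(G)$ has an irreducible subrepresentation that is not trivial. -/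

import Mathlib

/-- A reference orientation of a simple graph: every edge gets a tail `e⁻` and a head `e⁺`. -/
structure EdgeOrientation {V : Type*} (G : SimpleGraph V) where
  tail : G.edgeSet → V
  head : G.edgeSet → V
  mk_tail_head : ∀ e, s(tail e, head e) = (e : Sym2 V)

namespace EdgeOrientation

variable {V : Type*} {G : SimpleGraph V} (O : EdgeOrientation G)

open Classical in
/-- The incidence matrix `D` of the oriented graph. -/
noncomputable def incidence (𝕜 : Type*) [Field 𝕜] : Matrix V G.edgeSet 𝕜 :=
  fun v e => if v = O.head e then 1 else if v = O.tail e then -1 else 0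

/-- The cycle space `Z(G) = ker D`, with scalars in `𝕜`. -/
noncomputable def cycleSpace (𝕜 : Type*) [Field 𝕜] [Fintype G.edgeSet] :
    Submodule 𝕜 (G.edgeSet → 𝕜) :=
  LinearMap.ker (O.incidence 𝕜).mulVecLin

/-- The cut space `B(G)`: all edge functions `f` with `∑ e, f e * z e = 0` for every `z ∈ Z(G)`.
For `𝕜 = ℝ` this is the orthogonal complement of `Z(G)`; for `𝕜 = ℂ` it is the complexification of
that complement (and again the Hermitian orthogonal complement, since `Z(G)` is closed under
conjugation). -/
noncomputable def cutSpace (𝕜 : Type*) [Field 𝕜] [Fintype G.edgeSet] :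
    Submodule 𝕜 (G.edgeSet → 𝕜) where
  carrier := {f | ∀ z ∈ O.cycleSpace 𝕜, f ⬝ᵥ z = 0}
  add_mem' := by
    intro a b ha hb z hz
    rw [add_dotProduct, ha z hz, hb z hz, add_zero]
  zero_mem' := fun z _ => zero_dotProduct z
  smul_mem' := by
    intro c a ha z hz
    rw [smul_dotProduct, ha z hz, smul_zero]

/-- The group `Cy(G)` of all linear isometries of `ℓ₁(E)` that leave the real cycle space
invariant. -/
def cyGroup [Fintype G.edgeSet] : Subgroup ((G.edgeSet → ℝ) ≃ₗ[ℝ] (G.edgeSet → ℝ)) where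
  carrier := {ω | (∀ f, ∑ e, |ω f e| = ∑ e, |f e|) ∧
    (O.cycleSpace ℝ).map (ω : (G.edgeSet → ℝ) →ₗ[ℝ] (G.edgeSet → ℝ)) = O.cycleSpace ℝ}
  mul_mem' := by
    rintro a b ⟨ha, ha'⟩ ⟨hb, hb'⟩
    refine ⟨fun f => ?_, ?_⟩
    · rw [LinearEquiv.mul_apply, ha, hb]
    · ext x
      constructor
      · rintro ⟨y, hy, rfl⟩
        have h1 : b y ∈ O.cycleSpace ℝ := hb' ▸ ⟨y, hy, rfl⟩
        exact (ha' ▸ ⟨b y, h1, rfl⟩ : a (b y) ∈ O.cycleSpace ℝ)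
      · intro hx
        obtain ⟨y, hy, rfl⟩ := ha'.symm ▸ hx
        obtain ⟨z, hz, rfl⟩ := hb'.symm ▸ hy
        exact ⟨z, hz, rfl⟩
  one_mem' := ⟨fun _ => rfl, Submodule.map_id _⟩
  inv_mem' := by
    rintro a ⟨ha, ha'⟩
    have key : ∀ f, a (a⁻¹ f) = f := fun f => a.apply_symm_apply f
    have key' : ∀ f, a⁻¹ (a f) = f := fun f => a.symm_apply_apply f
    refine ⟨fun f => ?_, ?_⟩
    · rw [← ha, key]
    · ext x
      constructor
      · rintro ⟨y, hy, rfl⟩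
        obtain ⟨z, hz, rfl⟩ := ha'.symm ▸ hy
        exact (key' z).symm ▸ hz
      · intro hx
        exact ⟨a x, ha' ▸ ⟨x, hx, rfl⟩, key' x⟩

/-- `P` is an invariant projection of `ℓ₁(E)` onto `Z(G)`: a linear projection with range `Z(G)`
that commutes with all elements of `Cy(G)`. -/
def IsInvariantProjection [Fintype G.edgeSet]
    (P : (G.edgeSet → ℝ) →ₗ[ℝ] (G.edgeSet → ℝ)) : Prop :=
  LinearMap.IsProj (O.cycleSpace ℝ) P ∧ ∀ ω ∈ O.cyGroup, ∀ f, P (ω f) = ω (P f)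

open Classical in
/-- `1` if the automorphism `ψ` carries the orientation of `e` to that of `ψ e`, else `-1`. -/
noncomputable def sign (𝕜 : Type*) [Field 𝕜] (ψ : G ≃g G) (e : G.edgeSet) : 𝕜 :=
  if ψ (O.head e) = O.head (ψ.mapEdgeSet e) then 1 else -1

theorem head_ne_tail (e : G.edgeSet) : O.head e ≠ O.tail e := by
  intro h
  have h1 : s(O.tail e, O.head e) ∈ G.edgeSet := by rw [O.mk_tail_head]; exact e.2
  rw [SimpleGraph.mem_edgeSet] at h1
  exact h1.ne h.symm

theorem map_cases (ψ : G ≃g G) (e : G.edgeSet) :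
    (ψ (O.head e) = O.head (ψ.mapEdgeSet e) ∧ ψ (O.tail e) = O.tail (ψ.mapEdgeSet e)) ∨
    (ψ (O.head e) = O.tail (ψ.mapEdgeSet e) ∧ ψ (O.tail e) = O.head (ψ.mapEdgeSet e)) := by
  have h : s(O.tail (ψ.mapEdgeSet e), O.head (ψ.mapEdgeSet e)) =
      s(ψ (O.tail e), ψ (O.head e)) := by
    rw [O.mk_tail_head]
    change Sym2.map ψ (e : Sym2 V) = _
    rw [← O.mk_tail_head e, Sym2.map_mk]
  rw [Sym2.eq_iff] at h
  rcases h with h | h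
  · exact Or.inl ⟨h.2.symm, h.1.symm⟩
  · exact Or.inr ⟨h.1.symm, h.2.symm⟩

theorem incidence_map (𝕜 : Type*) [Field 𝕜] (ψ : G ≃g G) (v : V) (e : G.edgeSet) :
    O.incidence 𝕜 (ψ v) (ψ.mapEdgeSet e) = O.sign 𝕜 ψ e * O.incidence 𝕜 v e := by
  have h0 := O.head_ne_tail (ψ.mapEdgeSet e)
  have h1 := O.head_ne_tail e
  rcases O.map_cases ψ e with ⟨h, h'⟩ | ⟨h, h'⟩
  · unfold incidence sign
    rw [← h, ← h']
    rw [if_pos rfl, one_mul]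
    by_cases hv : v = O.head e
    · subst hv
      simp
    · by_cases hv' : v = O.tail e
      · subst hv'
        simp [hv]
      · simp [hv, hv']
  · unfold incidence sign
    rw [← h, ← h']
    simp only [ψ.injective.eq_iff, h1, if_false]
    by_cases hv : v = O.head e
    · subst hv
      simp [h1]
    · by_cases hv' : v = O.tail e
      · subst hv'
        simp [h1.symm]
      · simp [hv, hv']

theorem mapEdgeSet_mul (φ ψ : G ≃g G) (e : G.edgeSet) :
    (φ * ψ).mapEdgeSet e = φ.mapEdgeSet (ψ.mapEdgeSet e) := by
  apply Subtype.ext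
  change Sym2.map (φ ∘ ψ) (e : Sym2 V) = Sym2.map φ (Sym2.map ψ e)
  rw [Sym2.map_map]

theorem mapEdgeSet_one (e : G.edgeSet) : (1 : G ≃g G).mapEdgeSet e = e := by
  apply Subtype.ext
  change Sym2.map id (e : Sym2 V) = e
  rw [Sym2.map_id, id]

theorem sign_mul (𝕜 : Type*) [Field 𝕜] (φ ψ : G ≃g G) (e : G.edgeSet) :
    O.sign 𝕜 (φ * ψ) e = O.sign 𝕜 φ (ψ.mapEdgeSet e) * O.sign 𝕜 ψ e := by
  have h := O.incidence_map 𝕜 (φ * ψ) (O.head e) e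
  have h1 := O.incidence_map 𝕜 φ (ψ (O.head e)) (ψ.mapEdgeSet e)
  have h2 := O.incidence_map 𝕜 ψ (O.head e) e
  have h3 : O.incidence 𝕜 (O.head e) e = 1 := by simp [incidence]
  rw [mapEdgeSet_mul] at h
  rw [h3, mul_one] at h h2
  rw [h2] at h1
  rw [← h, ← h1]
  rfl

theorem sign_one (𝕜 : Type*) [Field 𝕜] (e : G.edgeSet) : O.sign 𝕜 (1 : G ≃g G) e = 1 := by
  have h := O.incidence_map 𝕜 (1 : G ≃g G) (O.head e) e
  have h3 : O.incidence 𝕜 (O.head e) e = 1 := by simp [incidence]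
  rw [mapEdgeSet_one] at h
  rw [show (1 : G ≃g G) (O.head e) = O.head e from rfl, h3, mul_one] at h
  exact h.symm

/-- The natural representation of `Aut(G)` on the edge space: `φ` sends the unit vector of the
oriented edge `uv` to that of the oriented edge `φ(u)φ(v)`, where the unit vector of an edge
with the orientation opposite to the reference one is minus its unit vector. -/
noncomputable def edgeRep (𝕜 : Type*) [Field 𝕜] : Representation 𝕜 (G ≃g G) (G.edgeSet → 𝕜) where
  toFun φ :=
    { toFun := fun f e => O.sign 𝕜 φ⁻¹ e * f (φ⁻¹.mapEdgeSet e)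
      map_add' := fun f g => by ext e; simp [mul_add]
      map_smul' := fun c f => by ext e; simp [mul_left_comm] }
  map_one' := by
    apply LinearMap.ext
    intro f
    funext e
    simp only [inv_one, LinearMap.coe_mk, AddHom.coe_mk, sign_one, mapEdgeSet_one, one_mul,
      Module.End.one_apply]
  map_mul' φ ψ := by
    apply LinearMap.ext
    intro f
    funext e
    simp only [mul_inv_rev, LinearMap.coe_mk, AddHom.coe_mk, Module.End.mul_apply, sign_mul,
      mapEdgeSet_mul]
    ring

theorem edgeRep_apply (𝕜 : Type*) [Field 𝕜] (φ : G ≃g G) (f : G.edgeSet → 𝕜) (e : G.edgeSet) :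
    O.edgeRep 𝕜 φ f e = O.sign 𝕜 φ⁻¹ e * f (φ⁻¹.mapEdgeSet e) := rfl

theorem edgeRep_mem_cycleSpace (𝕜 : Type*) [Field 𝕜] [Fintype G.edgeSet] (φ : G ≃g G)
    ⦃f : G.edgeSet → 𝕜⦄ (hf : f ∈ O.cycleSpace 𝕜) : O.edgeRep 𝕜 φ f ∈ O.cycleSpace 𝕜 := by
  rw [cycleSpace, LinearMap.mem_ker] at hf ⊢
  funext v
  have h := congrFun hf (φ⁻¹ v)
  rw [Matrix.mulVecLin_apply] at h ⊢
  refine Eq.trans ?_ h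
  simp only [Matrix.mulVec, dotProduct]
  refine Fintype.sum_equiv (φ⁻¹).mapEdgeSet _ _ fun e => ?_
  rw [incidence_map, edgeRep_apply]
  ring

theorem dotProduct_edgeRep (𝕜 : Type*) [Field 𝕜] [Fintype G.edgeSet] (φ : G ≃g G)
    (f z : G.edgeSet → 𝕜) : O.edgeRep 𝕜 φ f ⬝ᵥ z = f ⬝ᵥ O.edgeRep 𝕜 φ⁻¹ z := by
  simp only [dotProduct]
  refine Fintype.sum_equiv (φ⁻¹).mapEdgeSet _ _ fun e => ?_
  have h1 : φ.mapEdgeSet (φ⁻¹.mapEdgeSet e) = e := by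
    rw [← mapEdgeSet_mul, mul_inv_cancel, mapEdgeSet_one]
  have h2 := O.sign_mul 𝕜 φ φ⁻¹ e
  rw [mul_inv_cancel, sign_one] at h2
  have h3 : O.sign 𝕜 φ⁻¹ e * O.sign 𝕜 φ⁻¹ e = 1 := by
    unfold sign
    split_ifs <;> simp
  have h4 : O.sign 𝕜 φ (φ⁻¹.mapEdgeSet e) = O.sign 𝕜 φ⁻¹ e := by
    calc _ = O.sign 𝕜 φ (φ⁻¹.mapEdgeSet e) * (O.sign 𝕜 φ⁻¹ e * O.sign 𝕜 φ⁻¹ e) := by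
          rw [h3, mul_one]
      _ = _ := by rw [← mul_assoc, ← h2, one_mul]
  rw [edgeRep_apply, edgeRep_apply, inv_inv, h1, h4]
  ring

theorem edgeRep_mem_cutSpace (𝕜 : Type*) [Field 𝕜] [Fintype G.edgeSet] (φ : G ≃g G)
    ⦃f : G.edgeSet → 𝕜⦄ (hf : f ∈ O.cutSpace 𝕜) : O.edgeRep 𝕜 φ f ∈ O.cutSpace 𝕜 := by
  intro z hz
  rw [dotProduct_edgeRep]
  exact hf _ (O.edgeRep_mem_cycleSpace 𝕜 _ hz)

/-- The natural representation of `Aut(G)` on the cycle space. -/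
noncomputable def cycleRep (𝕜 : Type*) [Field 𝕜] [Fintype G.edgeSet] :
    Representation 𝕜 (G ≃g G) (O.cycleSpace 𝕜) :=
  Subrepresentation.toRepresentation (ρ := O.edgeRep 𝕜)
    ⟨O.cycleSpace 𝕜, O.edgeRep_mem_cycleSpace 𝕜⟩

/-- The natural representation of `Aut(G)` on the cut space. -/
noncomputable def cutRep (𝕜 : Type*) [Field 𝕜] [Fintype G.edgeSet] :
    Representation 𝕜 (G ≃g G) (O.cutSpace 𝕜) :=
  Subrepresentation.toRepresentation (ρ := O.edgeRep 𝕜)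
    ⟨O.cutSpace 𝕜, O.edgeRep_mem_cutSpace 𝕜⟩

end EdgeOrientation

section Cayley

open scoped Pointwise

/-- The right-invariant Cayley graph `Cay(Γ, X)`: `g` and `h` are adjacent iff `h * g⁻¹ ∈ X`. -/
def rightCayley {Γ : Type*} [Group Γ] (X : Set Γ) (hinv : X⁻¹ = X) (hone : (1 : Γ) ∉ X) :
    SimpleGraph Γ where
  Adj g h := h * g⁻¹ ∈ X
  symm := ⟨fun g h hgh => by
    rw [← hinv, Set.mem_inv]
    simpa using hgh⟩
  loopless := ⟨fun g hg => hone (by simpa using hg)⟩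

/-- The action of `Γ` on `Cay(Γ, X)` by translations: `a` acts by `g ↦ g * a⁻¹`. -/
def rightTranslation {Γ : Type*} [Group Γ] (X : Set Γ) (hinv : X⁻¹ = X) (hone : (1 : Γ) ∉ X) :
    Γ →* (rightCayley X hinv hone ≃g rightCayley X hinv hone) where
  toFun a := ⟨Equiv.mulRight a⁻¹, by intro g h; simp [rightCayley]⟩
  map_one' := by ext g; simp
  map_mul' a b := by
    ext g
    change g * (a * b)⁻¹ = g * b⁻¹ * a⁻¹
    rw [mul_inv_rev, mul_assoc]

end Cayley

/-!
Part 1 asks for a nonzero linear map on the edge space that commutes with `Cy(G)`, maps into the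
cycle space and vanishes on it: such a map can be added to any invariant projection. The proof
first shows that `Cy(G)` is no larger than the group itself, up to scalars, and then writes down
such a map.

A graphical regular representation on more than two vertices has degree at least three
(`three_le_ncard`), since the cycles have reflections. A connected vertex-transitive graph of degree
at least three is 3-connected (`SimpleGraph.isTwoInseparable_of_vertexTransitive`): the boundary of
an atom, a smallest piece that can be cut off by the least number of vertices, is a union of atoms,
so if it had at most two vertices the atom would be too small. For a 3-connected graph Whitney's
theorem `EdgeOrientation.exists_eq_smul_edgeRep` says that every element of `Cy(G)` is a scalar
multiple of the action of a graph automorphism, which here is a translation. Its proof is linear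
algebra: an `ℓ₁`-isometry is a signed permutation, hence also preserves the cut space, and the
cuts around vertices are recognised among the elements of the cut space by the connectedness of the
cycle matroid outside their support.

By 3-connectedness there is a cycle `z` that avoids the vertex `1`, and by transitivity some
translation does not fix it (`exists_edgeRep_ne_self`). Therefore
`f ↦ ∑ g, (D f) g⁻¹ • (g • z)` is a map as required for part 1 (`exists_equivariant_ne_zero`).
The same cycle gives part 3: the kernel of averaging on the cycle space is nonzero and contains no
nonzero fixed vector, so its irreducible subrepresentations are nontrivial.

For part 2, the coboundary identifies the cut space with the functions on the group modulo
constants. The matrix coefficients of a nontrivial irreducible representation embed it there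
(`exists_injective_intertwiningMap_cutRep`), and there are no nonzero fixed vectors
(`eq_zero_of_edgeRep_eq_self`).
-/

/-! ### Connectivity of vertex-transitive graphs -/

namespace SimpleGraph

variable {V : Type*} (G : SimpleGraph V)

section Atoms

variable [Fintype V]

open Classical in
/-- The closed neighbourhood of a set of vertices: the set together with all its neighbours. -/
noncomputable def closedNhd (A : Finset V) : Finset V :=
  Finset.univ.filter fun x => x ∈ A ∨ ∃ a ∈ A, G.Adj a x

variable {G}

theorem mem_closedNhd {A : Finset V} {x : V} :
    x ∈ G.closedNhd A ↔ x ∈ A ∨ ∃ a ∈ A, G.Adj a x := by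
  simp [closedNhd]

theorem subset_closedNhd (A : Finset V) : A ⊆ G.closedNhd A :=
  fun _ hx => mem_closedNhd.2 (Or.inl hx)

theorem closedNhd_mono {A B : Finset V} (h : A ⊆ B) : G.closedNhd A ⊆ G.closedNhd B := by
  intro x hx
  rcases mem_closedNhd.1 hx with hx | ⟨a, ha, hax⟩
  · exact mem_closedNhd.2 (Or.inl (h hx))
  · exact mem_closedNhd.2 (Or.inr ⟨a, h ha, hax⟩)

theorem closedNhd_union [DecidableEq V] (A B : Finset V) :
    G.closedNhd (A ∪ B) = G.closedNhd A ∪ G.closedNhd B := by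
  ext x
  simp only [mem_closedNhd, Finset.mem_union]
  grind

theorem closedNhd_image [DecidableEq V] (φ : G ≃g G) (A : Finset V) :
    G.closedNhd (A.image φ) = (G.closedNhd A).image φ := by
  ext x
  obtain ⟨y, rfl⟩ := φ.surjective x
  simp [mem_closedNhd, Finset.mem_image, φ.injective.eq_iff, φ.map_adj_iff]

theorem card_closedNhd_union_add_inter [DecidableEq V] (A B : Finset V) :
    (G.closedNhd (A ∪ B)).card + (G.closedNhd (A ∩ B)).card ≤
      (G.closedNhd A).card + (G.closedNhd B).card := by
  rw [closedNhd_union, ← Finset.card_union_add_card_inter (G.closedNhd A)]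
  gcongr
  exact Finset.subset_inter (closedNhd_mono Finset.inter_subset_left)
    (closedNhd_mono Finset.inter_subset_right)

theorem eq_univ_of_closedNhd_eq (hG : G.Preconnected) {A : Finset V} (hA : A.Nonempty)
    (h : G.closedNhd A = A) : A = Finset.univ := by
  obtain ⟨a, ha⟩ := hA
  refine Finset.eq_univ_iff_forall.2 fun x => ?_
  have hax := (SimpleGraph.reachable_iff_reflTransGen a x).1 (hG a x)
  induction hax with
  | refl => exact ha
  | tail _ hbc ih =>
    rw [← h]
    exact mem_closedNhd.2 (Or.inr ⟨_, ih, hbc⟩)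

variable (G) in
/-- A fragment: a nonempty set of vertices whose closed neighbourhood is not the whole graph, so
that its outer boundary separates it from the rest. -/
def IsFragment (A : Finset V) : Prop := A.Nonempty ∧ G.closedNhd A ≠ Finset.univ

variable (G) in
/-- An atom: a fragment whose outer boundary is as small as possible, and which has the least
number of vertices among the fragments with this property. Differences of cardinalities are
written additively. -/
structure IsAtom (A : Finset V) : Prop where
  isFragment : G.IsFragment A
  card_boundary_le : ∀ F, G.IsFragment F →
    (G.closedNhd A).card + F.card ≤ (G.closedNhd F).card + A.card
  card_le : ∀ F, G.IsFragment F →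
    (G.closedNhd A).card + F.card = (G.closedNhd F).card + A.card → A.card ≤ F.card

theorem exists_isAtom {F : Finset V} (hF : G.IsFragment F) : ∃ A, G.IsAtom A := by
  classical
  obtain ⟨A, hA, hmin⟩ := Finset.exists_min_image (Finset.univ.filter G.IsFragment)
    (fun A => (G.closedNhd A).card - A.card) ⟨F, by simpa using hF⟩
  obtain ⟨B, hB, hmin'⟩ := Finset.exists_min_image
    (Finset.univ.filter fun B => G.IsFragment B ∧
      (G.closedNhd B).card - B.card = (G.closedNhd A).card - A.card)
    Finset.card ⟨A, by simpa using hA⟩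
  simp only [Finset.mem_filter, Finset.mem_univ, true_and] at hA hmin hB hmin'
  refine ⟨B, hB.1, fun C hC => ?_, fun C hC h => hmin' C ⟨hC, ?_⟩⟩
  all_goals
    have h1 := hmin C hC
    have h2 := Finset.card_le_card (G.subset_closedNhd C)
    have h3 := Finset.card_le_card (G.subset_closedNhd B)
    have h4 := Finset.card_le_card (G.subset_closedNhd A)
    have h5 := hB.2
    omega

namespace IsAtom

variable {A B F : Finset V}

theorem card_eq (hA : G.IsAtom A) (hB : G.IsAtom B) :
    A.card = B.card ∧ (G.closedNhd A).card = (G.closedNhd B).card := by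
  have h1 := hA.card_boundary_le B hB.isFragment
  have h2 := hB.card_boundary_le A hA.isFragment
  have h3 := hA.card_le B hB.isFragment (by omega)
  have h4 := hB.card_le A hA.isFragment (by omega)
  omega

variable [DecidableEq V]

theorem image (hA : G.IsAtom A) (φ : G ≃g G) : G.IsAtom (A.image φ) := by
  have h1 : (A.image φ).card = A.card := Finset.card_image_of_injective _ φ.injective
  have h2 : (G.closedNhd (A.image φ)).card = (G.closedNhd A).card := by
    rw [closedNhd_image, Finset.card_image_of_injective _ φ.injective]
  refine ⟨⟨hA.isFragment.1.image φ, fun h => hA.isFragment.2 ?_⟩, ?_, ?_⟩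
  · rw [← Finset.card_eq_iff_eq_univ] at h ⊢
    rw [← h2, h]
  · rw [h1, h2]
    exact hA.card_boundary_le
  · rw [h1, h2]
    exact hA.card_le

/-- The set of vertices outside the closed neighbourhood of an atom is a fragment with a boundary
of the same size. -/
theorem compl (hA : G.IsAtom A) : G.IsFragment (G.closedNhd A)ᶜ ∧
    (G.closedNhd A).card + (G.closedNhd A)ᶜ.card =
      (G.closedNhd (G.closedNhd A)ᶜ).card + A.card := by
  have hsub : G.closedNhd (G.closedNhd A)ᶜ ⊆ Aᶜ := by
    intro x hx
    rw [Finset.mem_compl]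
    intro hxA
    rcases mem_closedNhd.1 hx with h | ⟨a, ha, hax⟩
    · exact Finset.mem_compl.1 h (subset_closedNhd A hxA)
    · exact Finset.mem_compl.1 ha (mem_closedNhd.2 (Or.inr ⟨x, hxA, hax.symm⟩))
  have hfrag : G.IsFragment (G.closedNhd A)ᶜ := by
    refine ⟨?_, fun h => ?_⟩
    · rw [Finset.nonempty_iff_ne_empty, Ne, Finset.compl_eq_empty_iff]
      exact hA.isFragment.2
    · obtain ⟨a, ha⟩ := hA.isFragment.1
      have := hsub (h ▸ Finset.mem_univ a)
      exact Finset.mem_compl.1 this ha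
  refine ⟨hfrag, le_antisymm (hA.card_boundary_le _ hfrag) ?_⟩
  have h1 := Finset.card_le_card hsub
  have h2 := Finset.card_add_card_compl A
  have h3 := Finset.card_add_card_compl (G.closedNhd A)
  omega

/-- An atom that meets a set with a boundary of minimal size lies inside it, provided the
set is not too large. This is submodularity of the size of the boundary: if the
intersection were smaller than the atom, its boundary would be larger, and so the boundary of the
union would be too small. -/
theorem subset_of_inter_nonempty (hA : G.IsAtom A)
    (hmin : (G.closedNhd A).card + F.card = (G.closedNhd F).card + A.card)
    (hcard : F.card ≤ (G.closedNhd A)ᶜ.card) (hAF : (A ∩ F).Nonempty) : A ⊆ F := by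
  have hI : G.IsFragment (A ∩ F) := by
    refine ⟨hAF, fun h => hA.isFragment.2 ?_⟩
    rw [← Finset.univ_subset_iff, ← h]
    exact closedNhd_mono Finset.inter_subset_left
  have h1 := G.card_closedNhd_union_add_inter A F
  have h2 := Finset.card_union_add_card_inter A F
  have h3 := Finset.card_add_card_compl (G.closedNhd A)
  have h4 := hAF.card_pos
  have h5 := hA.card_boundary_le _ hI
  have hU : (G.closedNhd A).card + (A ∪ F).card ≤ (G.closedNhd (A ∪ F)).card + A.card := by
    by_cases h : G.closedNhd (A ∪ F) = Finset.univ
    · rw [h, Finset.card_univ]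
      omega
    · exact hA.card_boundary_le _ ⟨hA.isFragment.1.mono Finset.subset_union_left, h⟩
  have h6 := hA.card_le _ hI (by omega)
  have h7 := Finset.eq_of_subset_of_card_le Finset.inter_subset_left h6
  exact Finset.inter_eq_left.1 h7

/-- An atom that contains a boundary vertex of another atom is contained in the boundary. -/
theorem subset_sdiff (hA : G.IsAtom A) (hB : G.IsAtom B) {b : V} (hb : b ∈ B)
    (hbA : b ∈ G.closedNhd A) (hbA' : b ∉ A) : B ⊆ G.closedNhd A \ A := by
  obtain ⟨hcard, hcard'⟩ := hA.card_eq hB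
  have hcompl := hA.compl
  have h0 := Finset.card_add_card_compl (G.closedNhd A)
  have h1 := Finset.card_add_card_compl (G.closedNhd B)
  intro x hx
  rw [Finset.mem_sdiff]
  constructor
  · by_contra hxA
    refine Finset.mem_compl.1 (hB.subset_of_inter_nonempty ?_ ?_
      ⟨x, Finset.mem_inter.2 ⟨hx, Finset.mem_compl.2 hxA⟩⟩ hb) hbA
    · omega
    · omega
  · intro hxA
    refine hbA' (hB.subset_of_inter_nonempty ?_ ?_
      ⟨x, Finset.mem_inter.2 ⟨hx, hxA⟩⟩ hb)
    · omega
    · have h2 := Finset.card_le_card (subset_closedNhd (G := G) (G.closedNhd A)ᶜ)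
      have h3 := hA.card_le _ hcompl.1 hcompl.2
      omega

/-- In a connected vertex-transitive graph of degree at least three, the boundary of an atom has
more than two vertices. The boundary is a union of atoms, so an atom would have at most two
vertices; one vertex is impossible because of the degree, and if there are two, then the atom and
its boundary are each other's boundaries, and together they are the whole graph. -/
theorem card_add_two_lt (hG : G.Preconnected) (htrans : ∀ x y, ∃ φ : G ≃g G, φ x = y)
    (hdeg : ∀ x, 3 ≤ (G.neighborSet x).ncard) (hA : G.IsAtom A) :
    A.card + 2 < (G.closedNhd A).card := by
  by_contra! hle
  have hne : G.closedNhd A ≠ A := fun h =>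
    hA.isFragment.2 (h.trans (eq_univ_of_closedNhd_eq hG hA.isFragment.1 h))
  obtain ⟨b, hbA, hbA'⟩ : ∃ b ∈ G.closedNhd A, b ∉ A := by
    by_contra! h
    exact hne (Finset.Subset.antisymm h (subset_closedNhd A))
  obtain ⟨a, haA, hab⟩ := (mem_closedNhd.1 hbA).resolve_left hbA'
  obtain ⟨φ, rfl⟩ := htrans a b
  have hB := hA.image φ
  have hb : φ a ∈ A.image φ := Finset.mem_image_of_mem _ haA
  have hBA := hA.subset_sdiff hB hb hbA hbA'
  have hAB := hB.subset_sdiff hA haA (mem_closedNhd.2 (Or.inr ⟨_, hb, hab.symm⟩))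
    (fun h => (Finset.mem_sdiff.1 (hBA h)).2 haA)
  have hcard := hA.card_eq hB
  have h1 := Finset.card_le_card hBA
  rw [Finset.card_sdiff_of_subset (subset_closedNhd A)] at h1
  have h2 := hA.isFragment.1.card_pos
  by_cases hone : A.card = 1
  · obtain ⟨x, rfl⟩ := Finset.card_eq_one.1 hone
    have h3 : insert x (G.neighborSet x) ⊆ (G.closedNhd {x} : Set V) := by
      intro y hy
      rw [Finset.mem_coe, mem_closedNhd]
      rcases hy with rfl | hy
      · simp
      · exact Or.inr ⟨x, by simp, hy⟩
    have h4 := Set.ncard_le_ncard h3 (Finset.finite_toSet _)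
    rw [Set.ncard_coe_finset, Set.ncard_insert_of_notMem (by simp)] at h4
    have := hdeg x
    simp only [Finset.card_singleton] at hle
    omega
  · have h5 : A.image φ = G.closedNhd A \ A := by
      refine Finset.eq_of_subset_of_card_le hBA ?_
      rw [Finset.card_sdiff_of_subset (subset_closedNhd A)]
      omega
    have h6 : A = G.closedNhd (A.image φ) \ A.image φ := by
      refine Finset.eq_of_subset_of_card_le hAB ?_
      rw [Finset.card_sdiff_of_subset (subset_closedNhd _)]
      omega
    have h7 : G.closedNhd A = A ∪ A.image φ := by
      rw [h5, Finset.union_sdiff_of_subset (subset_closedNhd A)]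
    have h8 : G.closedNhd (A.image φ) = A ∪ A.image φ := by
      rw [← Finset.sdiff_union_of_subset (subset_closedNhd (A.image φ)), ← h6]
    refine hA.isFragment.2 (eq_univ_of_closedNhd_eq hG ⟨_, hbA⟩ ?_)
    conv_lhs => rw [h7, closedNhd_union, h8, h7, Finset.union_self]
    rw [h7]

end IsAtom

end Atoms

/-- The step relation of paths that avoid `u` and `v`. -/
def AvoidAdj (u v x y : V) : Prop := G.Adj x y ∧ y ≠ u ∧ y ≠ v

/-- No two vertices separate the graph: any two other vertices are joined by a path avoiding them.
Since the two deleted vertices may coincide, no single vertex separates the graph either. -/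
def IsTwoInseparable : Prop :=
  ∀ u v a b : V, a ≠ u → a ≠ v → b ≠ u → b ≠ v → Relation.ReflTransGen (G.AvoidAdj u v) a b

variable {G}

theorem isTwoInseparable_of_vertexTransitive [Finite V] (hG : G.Preconnected)
    (htrans : ∀ x y, ∃ φ : G ≃g G, φ x = y) (hdeg : ∀ x, 3 ≤ (G.neighborSet x).ncard) :
    G.IsTwoInseparable := by
  classical
  cases nonempty_fintype V
  intro u v a b _ _ hbu hbv
  by_contra hab
  let S : Finset V := Finset.univ.filter fun x => Relation.ReflTransGen (G.AvoidAdj u v) a x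
  have hS : ∀ x, x ∈ S ↔ Relation.ReflTransGen (G.AvoidAdj u v) a x := by simp [S]
  have hcl : G.closedNhd S ⊆ S ∪ {u, v} := by
    intro x hx
    by_cases hxu : x = u
    · simp [hxu]
    by_cases hxv : x = v
    · simp [hxv]
    rcases mem_closedNhd.1 hx with h | ⟨s, hs, hsx⟩
    · exact Finset.mem_union_left _ h
    · exact Finset.mem_union_left _ ((hS x).2 (((hS s).1 hs).tail ⟨hsx, hxu, hxv⟩))
  have hfrag : G.IsFragment S := by
    refine ⟨⟨a, (hS a).2 .refl⟩, fun h => ?_⟩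
    have := hcl (h ▸ Finset.mem_univ b)
    simp [hS, hab, hbu, hbv] at this
  obtain ⟨A, hA⟩ := exists_isAtom hfrag
  have h1 := hA.card_add_two_lt hG htrans hdeg
  have h2 := hA.card_boundary_le S hfrag
  have h3 := (Finset.card_le_card hcl).trans (Finset.card_union_le _ _)
  have h4 := Finset.card_le_two (a := u) (b := v)
  omega

end SimpleGraph

/-! ### Flows and potentials -/

namespace EdgeOrientation

variable {V : Type*} {G : SimpleGraph V} (O : EdgeOrientation G)

open scoped Matrix

section Incidence

variable (𝕜 : Type*) [Field 𝕜]

theorem incidence_head (e : G.edgeSet) : O.incidence 𝕜 (O.head e) e = 1 := by simp [incidence]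

theorem incidence_tail (e : G.edgeSet) : O.incidence 𝕜 (O.tail e) e = -1 := by
  simp [incidence, (O.head_ne_tail e).symm]

theorem mem_iff (e : G.edgeSet) (v : V) : v ∈ (e : Sym2 V) ↔ v = O.tail e ∨ v = O.head e := by
  rw [← O.mk_tail_head e, Sym2.mem_iff]

theorem incidence_ne_zero_iff {e : G.edgeSet} {v : V} :
    O.incidence 𝕜 v e ≠ 0 ↔ v ∈ (e : Sym2 V) := by
  rw [O.mem_iff]
  unfold incidence
  split_ifs with h h' <;> simp [*]

theorem incidence_apply [DecidableEq V] (e : G.edgeSet) (v : V) :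
    O.incidence 𝕜 v e =
      (Pi.single (O.head e) 1 - Pi.single (O.tail e) 1 : V → 𝕜) v := by
  have h := O.head_ne_tail e
  simp only [incidence, Pi.sub_apply, Pi.single_apply]
  split_ifs <;> simp_all

variable [Fintype G.edgeSet]

variable {𝕜} in
theorem mem_cycleSpace {z : G.edgeSet → 𝕜} :
    z ∈ O.cycleSpace 𝕜 ↔ O.incidence 𝕜 *ᵥ z = 0 := by
  rw [cycleSpace, LinearMap.mem_ker, Matrix.mulVecLin_apply]

/-- A row of the incidence matrix, that is, the cut around a single vertex, lies in the cut
space. -/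
theorem incidence_mem_cutSpace (v : V) : O.incidence 𝕜 v ∈ O.cutSpace 𝕜 :=
  fun _ hz => congrFun (O.mem_cycleSpace.1 hz) v

/-- The unit flow from `x` to `y` along an edge joining them. -/
theorem exists_flow_of_adj [DecidableEq V] {x y : V} (h : G.Adj x y) :
    ∃ f : G.edgeSet → 𝕜, O.incidence 𝕜 *ᵥ f = Pi.single y 1 - Pi.single x 1 ∧
      ∀ e : G.edgeSet, (f e ≠ 0 ↔ (e : Sym2 V) = s(x, y)) := by
  classical
  let e : G.edgeSet := ⟨s(x, y), h⟩
  have he : ∀ e' : G.edgeSet, e' = e ↔ (e' : Sym2 V) = s(x, y) := fun e' => Subtype.ext_iff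
  have hcol : ∀ c : 𝕜, O.incidence 𝕜 *ᵥ Pi.single e c =
      c • (Pi.single (O.head e) 1 - Pi.single (O.tail e) 1) := by
    intro c
    funext v
    rw [Matrix.mulVec_single, Pi.smul_apply, Pi.smul_apply, ← O.incidence_apply]
    simp [Matrix.col, mul_comm]
  have hth : s(O.tail e, O.head e) = s(x, y) := O.mk_tail_head e
  rcases Sym2.eq_iff.1 hth with ⟨h1, h2⟩ | ⟨h1, h2⟩
  · refine ⟨Pi.single e 1, by rw [hcol, h1, h2, one_smul], fun e' => ?_⟩
    rw [← he, Pi.single_apply]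
    simp
  · refine ⟨Pi.single e (-1), by rw [hcol, h1, h2, neg_one_smul, neg_sub], fun e' => ?_⟩
    rw [← he, Pi.single_apply]
    simp

/-- A path whose vertices have the property `p` carries a unit flow between its ends. -/
theorem exists_flow [DecidableEq V] (p : V → Prop) {a b : V} (ha : p a)
    (h : Relation.ReflTransGen (fun x y => G.Adj x y ∧ p y) a b) :
    ∃ f : G.edgeSet → 𝕜, O.incidence 𝕜 *ᵥ f = Pi.single b 1 - Pi.single a 1 ∧
      ∀ e : G.edgeSet, f e ≠ 0 → ∀ x ∈ (e : Sym2 V), p x := by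
  suffices h' : p b ∧ ∃ f : G.edgeSet → 𝕜,
      O.incidence 𝕜 *ᵥ f = Pi.single b 1 - Pi.single a 1 ∧
      ∀ e : G.edgeSet, f e ≠ 0 → ∀ x ∈ (e : Sym2 V), p x from h'.2
  induction h with
  | refl => exact ⟨ha, 0, by simp, by simp⟩
  | @tail b c _ hbc ih =>
    obtain ⟨hb, f, hf, hf'⟩ := ih
    obtain ⟨s, hs, hs'⟩ := O.exists_flow_of_adj 𝕜 hbc.1
    refine ⟨hbc.2, f + s, by rw [Matrix.mulVec_add, hf, hs]; abel, fun e he x hx => ?_⟩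
    by_cases hfe : f e = 0
    · rw [Pi.add_apply, hfe, zero_add, hs'] at he
      rw [he, Sym2.mem_iff] at hx
      rcases hx with rfl | rfl
      exacts [hb, hbc.2]
    · exact hf' e hfe x hx

/-- Two edges `u a₁` and `u a₂` not containing `v` lie on a cycle that avoids `v`. -/
theorem exists_cycle (hG : G.IsTwoInseparable) {u v a₁ a₂ : V} (huv : u ≠ v) (h₁ : G.Adj u a₁)
    (h₂ : G.Adj u a₂) (h₁v : a₁ ≠ v) (h₂v : a₂ ≠ v) (hne : a₁ ≠ a₂) :
    ∃ z ∈ O.cycleSpace 𝕜, (∀ e : G.edgeSet, z e ≠ 0 → v ∉ (e : Sym2 V)) ∧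
      ∀ e : G.edgeSet, u ∈ (e : Sym2 V) →
        (z e ≠ 0 ↔ (e : Sym2 V) = s(u, a₁) ∨ (e : Sym2 V) = s(u, a₂)) := by
  classical
  obtain ⟨f, hf, hf'⟩ := O.exists_flow 𝕜 (fun x => x ≠ u ∧ x ≠ v) ⟨h₁.ne', h₁v⟩
    (hG u v a₁ a₂ h₁.ne' h₁v h₂.ne' h₂v)
  obtain ⟨s, hs, hs'⟩ := O.exists_flow_of_adj 𝕜 h₁
  obtain ⟨t, ht, ht'⟩ := O.exists_flow_of_adj 𝕜 h₂
  have hst : ∀ e : G.edgeSet, s e ≠ 0 → t e = 0 := by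
    intro e he
    by_contra hte
    rw [← Ne, ht', (hs' e).1 he, Sym2.congr_right] at hte
    exact hne hte
  refine ⟨f + s - t, ?_, fun e he hv => ?_, fun e hu => ?_⟩
  · rw [mem_cycleSpace, Matrix.mulVec_sub, Matrix.mulVec_add, hf, hs, ht]
    abel
  · have h0 : f e = 0 := by
      by_contra h
      exact (hf' e h v hv).2 rfl
    have h1 : s e = 0 := by
      by_contra h
      rw [(hs' e).1 h, Sym2.mem_iff] at hv
      rcases hv with rfl | rfl <;> contradiction
    have h2 : t e = 0 := by
      by_contra h
      rw [(ht' e).1 h, Sym2.mem_iff] at hv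
      rcases hv with rfl | rfl <;> contradiction
    simp [h0, h1, h2] at he
  · have h0 : f e = 0 := by
      by_contra h
      exact (hf' e h u hu).1 rfl
    rw [Pi.sub_apply, Pi.add_apply, h0, zero_add, ← hs', ← ht']
    by_cases hse : s e = 0
    · simp [hse]
    · simp [hse, hst e hse]

variable {𝕜}

/-- Every element of the cut space is the coboundary of a potential, obtained by pairing with
flows from a base point. -/
theorem exists_potential (hG : G.Preconnected) {b : G.edgeSet → 𝕜} (hb : b ∈ O.cutSpace 𝕜) :
    ∃ p : V → 𝕜, ∀ e, b e = p (O.head e) - p (O.tail e) := by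
  classical
  rcases isEmpty_or_nonempty V with hV | ⟨⟨x₀⟩⟩
  · exact ⟨0, fun e => isEmptyElim (O.head e)⟩
  have hflow : ∀ x, ∃ f : G.edgeSet → 𝕜,
      O.incidence 𝕜 *ᵥ f = Pi.single x 1 - Pi.single x₀ 1 := by
    intro x
    obtain ⟨f, hf, -⟩ := O.exists_flow 𝕜 (fun _ => True) trivial
      (Relation.ReflTransGen.mono (fun _ _ h => ⟨h, trivial⟩) _ _
        ((SimpleGraph.reachable_iff_reflTransGen x₀ x).1 (hG x₀ x)))
    exact ⟨f, hf⟩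
  choose f hf using hflow
  refine ⟨fun x => b ⬝ᵥ f x, fun e => ?_⟩
  have hz : Pi.single e 1 + f (O.tail e) - f (O.head e) ∈ O.cycleSpace 𝕜 := by
    rw [mem_cycleSpace, Matrix.mulVec_sub, Matrix.mulVec_add, hf, hf]
    funext v
    have := O.incidence_apply 𝕜 e v
    simp only [Pi.sub_apply, Pi.add_apply, Matrix.mulVec_single, Matrix.col_apply,
      MulOpposite.op_one, one_smul, Pi.zero_apply] at this ⊢
    rw [this]
    ring
  have h := hb _ hz
  rw [dotProduct_sub, dotProduct_add, dotProduct_single, mul_one] at h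
  linear_combination h

/-- A cycle whose edges each have both ends in the vertex set `p` or both outside it stays a cycle
when restricted to the edges inside `p`. -/
theorem indicator_mem_cycleSpace (p : V → Prop) [DecidablePred p] {z : G.edgeSet → 𝕜}
    (hz : z ∈ O.cycleSpace 𝕜) (hp : ∀ e, z e ≠ 0 → (p (O.head e) ↔ p (O.tail e))) :
    (fun e => if p (O.head e) then z e else 0) ∈ O.cycleSpace 𝕜 := by
  rw [mem_cycleSpace] at hz ⊢
  funext v
  have h := congrFun hz v
  simp only [Matrix.mulVec, dotProduct, Pi.zero_apply] at h ⊢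
  have key : ∀ e : G.edgeSet, O.incidence 𝕜 v e * (if p (O.head e) then z e else 0) =
      if p v then O.incidence 𝕜 v e * z e else 0 := by
    intro e
    by_cases hze : z e = 0
    · simp [hze]
    by_cases hv : O.incidence 𝕜 v e = 0
    · simp [hv]
    rw [← Ne, O.incidence_ne_zero_iff, O.mem_iff] at hv
    have := hp e hze
    rcases hv with rfl | rfl
    · simp [this]
    · simp
  rw [Finset.sum_congr rfl fun e _ => key e]
  split_ifs
  · exact h
  · simp

/-- The cycle matroid of `G - v` is connected: a set of edges such that every cycle avoiding `v`
splits along it contains all edges of `G - v` or none. -/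
theorem mem_of_forall_indicator_mem (hG : G.IsTwoInseparable) (v : V) (K : Set G.edgeSet)
    [DecidablePred (· ∈ K)]
    (hK : ∀ z ∈ O.cycleSpace 𝕜, (∀ e : G.edgeSet, z e ≠ 0 → v ∉ (e : Sym2 V)) →
      (fun e => if e ∈ K then z e else 0) ∈ O.cycleSpace 𝕜)
    {e₁ e₂ : G.edgeSet} (h₁ : e₁ ∈ K) (hv₁ : v ∉ (e₁ : Sym2 V)) (hv₂ : v ∉ (e₂ : Sym2 V)) :
    e₂ ∈ K := by
  classical
  -- Edges of `G - v` with a common end lie on a cycle of `G - v`, hence on the same side.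
  have hlocal : ∀ (w : V) (e e' : G.edgeSet), w ∈ (e : Sym2 V) → w ∈ (e' : Sym2 V) →
      v ∉ (e : Sym2 V) → v ∉ (e' : Sym2 V) → e ∈ K → e' ∈ K := by
    rintro w ⟨e, he⟩ ⟨e', he'⟩ hw hw' hve hve' heK
    obtain ⟨a, rfl⟩ := hw
    obtain ⟨a', rfl⟩ := hw'
    have hav : a ≠ v := fun h => hve (by simp [h])
    have hav' : a' ≠ v := fun h => hve' (by simp [h])
    have hwv : w ≠ v := fun h => hve (by simp [h])
    by_cases haa : a = a'
    · subst haa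
      exact heK
    obtain ⟨z, hz, hzv, hzw⟩ := O.exists_cycle 𝕜 hG hwv he he' hav hav' haa
    by_contra heK'
    have h := congrFun (O.mem_cycleSpace.1 (hK z hz hzv)) w
    simp only [Matrix.mulVec, dotProduct, Pi.zero_apply] at h
    rw [Finset.sum_eq_single ⟨s(w, a), he⟩ ?_ (by simp), if_pos heK] at h
    · refine mul_ne_zero ((O.incidence_ne_zero_iff 𝕜).2 ?_) ((hzw _ ?_).2 (Or.inl rfl)) h <;> simp
    · intro f _ hf
      by_cases hwf : w ∈ (f : Sym2 V)
      · rw [mul_eq_zero]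
        right
        split_ifs with hfK
        · by_contra hzf
          rcases (hzw f hwf).1 hzf with h' | h'
          · exact hf (Subtype.ext h')
          · exact heK' ((Subtype.ext h' : f = ⟨s(w, a'), he'⟩) ▸ hfK)
        · rfl
      · rw [← O.incidence_ne_zero_iff 𝕜, not_not] at hwf
        rw [hwf, zero_mul]
  have hx : O.head e₁ ∈ (e₁ : Sym2 V) := (O.mem_iff _ _).2 (Or.inr rfl)
  have hy : O.head e₂ ∈ (e₂ : Sym2 V) := (O.mem_iff _ _).2 (Or.inr rfl)
  have hxv : O.head e₁ ≠ v := fun h => hv₁ (h ▸ hx)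
  have hyv : O.head e₂ ≠ v := fun h => hv₂ (h ▸ hy)
  have hreach : ∀ y, Relation.ReflTransGen (G.AvoidAdj v v) (O.head e₁) y →
      y ≠ v ∧ ∃ e ∈ K, v ∉ (e : Sym2 V) ∧ y ∈ (e : Sym2 V) := by
    intro y hpath
    induction hpath with
    | refl => exact ⟨hxv, e₁, h₁, hv₁, hx⟩
    | @tail b c _ hbc ih =>
      obtain ⟨hbv, e, heK, hve, hbe⟩ := ih
      have hv : v ∉ s(b, c) := by
        rw [Sym2.mem_iff]
        rintro (h | h)
        exacts [hbv h.symm, hbc.2.1 h.symm]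
      exact ⟨hbc.2.1, ⟨s(b, c), hbc.1⟩,
        hlocal b e ⟨s(b, c), hbc.1⟩ hbe (by simp) hve hv heK, hv, by simp⟩
  obtain ⟨-, e, heK, hve, hmem⟩ := hreach _ (hG v v _ _ hxv hxv hyv hyv)
  exact hlocal _ e e₂ hmem hy hve hv₂ heK

end Incidence

end EdgeOrientation

/-! ### Isometries of `ℓ₁` are signed permutations -/

theorem abs_add_add_abs_sub_le (a b : ℝ) : |a + b| + |a - b| ≤ 2 * |a| + 2 * |b| := by
  have h1 := abs_add_le a b
  have h2 := abs_sub a b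
  linarith

theorem mul_eq_zero_of_abs_add_add_abs_sub_eq {a b : ℝ}
    (h : |a + b| + |a - b| = 2 * |a| + 2 * |b|) : a * b = 0 := by
  have h1 := abs_add_le a b
  have h2 := abs_sub a b
  have h3 : |a + b| = |a| + |b| := by linarith
  have h4 : |a - b| = |a| + |b| := by linarith
  have h5 := sq_abs (a + b)
  have h6 := sq_abs (a - b)
  rw [h3] at h5
  rw [h4] at h6
  linarith

/-- A linear isometry of `ℓ₁(ι)` permutes the unit vectors up to sign. It preserves disjointness of
supports, because `|a + b| + |a - b| ≤ 2|a| + 2|b|` is an equality only if `a b = 0`; so the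
images of the unit vectors have disjoint supports, which must be singletons. -/
theorem exists_signed_perm_of_l1_isometry {ι : Type*} [Fintype ι] (ω : (ι → ℝ) →ₗ[ℝ] (ι → ℝ))
    (hω : ∀ f, ∑ i, |ω f i| = ∑ i, |f i|) :
    ∃ (π : Equiv.Perm ι) (ε : ι → ℝ), (∀ i, |ε i| = 1) ∧ ∀ f i, ω f (π i) = ε i * f i := by
  classical
  have hsingle : ∀ i, ∑ k, |(Pi.single i 1 : ι → ℝ) k| = 1 := by
    intro i
    rw [Finset.sum_eq_single i] <;> simp +contextual
  have hdisj : ∀ i j, i ≠ j → ∀ k, ω (Pi.single i 1) k * ω (Pi.single j 1) k = 0 := by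
    intro i j hij k
    set x := ω (Pi.single i 1) with hx
    set y := ω (Pi.single j 1) with hy
    have hsum : ∑ k, (|x k + y k| + |x k - y k|) = ∑ k, (2 * |x k| + 2 * |y k|) := by
      rw [Finset.sum_add_distrib, Finset.sum_add_distrib, ← Finset.mul_sum, ← Finset.mul_sum]
      have h1 : ∑ k, |x k + y k| = ∑ k, |(Pi.single i 1 + Pi.single j 1 : ι → ℝ) k| := by
        rw [← hω (Pi.single i 1 + Pi.single j 1), map_add]
        rfl
      have h2 : ∑ k, |x k - y k| = ∑ k, |(Pi.single i 1 - Pi.single j 1 : ι → ℝ) k| := by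
        rw [← hω (Pi.single i 1 - Pi.single j 1), map_sub]
        rfl
      have h3 : ∀ k, |(Pi.single i 1 + Pi.single j 1 : ι → ℝ) k| =
          |(Pi.single i 1 : ι → ℝ) k| + |(Pi.single j 1 : ι → ℝ) k| := by
        intro k
        simp only [Pi.add_apply, Pi.single_apply]
        split_ifs <;> simp_all
      have h4 : ∀ k, |(Pi.single i 1 - Pi.single j 1 : ι → ℝ) k| =
          |(Pi.single i 1 : ι → ℝ) k| + |(Pi.single j 1 : ι → ℝ) k| := by
        intro k
        simp only [Pi.sub_apply, Pi.single_apply]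
        split_ifs <;> simp_all
      rw [h1, h2, hx, hy, hω, hω]
      simp only [h3, h4, Finset.sum_add_distrib, hsingle]
      norm_num
    exact mul_eq_zero_of_abs_add_add_abs_sub_eq
      ((Finset.sum_eq_sum_iff_of_le fun k _ => abs_add_add_abs_sub_le (x k) (y k)).1 hsum k
        (Finset.mem_univ k))
  have hex : ∀ i, ∃ k, ω (Pi.single i 1) k ≠ 0 := by
    intro i
    by_contra! h
    have := hω (Pi.single i 1)
    simp [h, hsingle] at this
  choose q hq using hex
  have hqinj : Function.Injective q := by
    intro i j hij
    by_contra hne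
    exact mul_ne_zero (hq i) (hij ▸ hq j) (hdisj i j hne (q i))
  have hzero : ∀ i j, i ≠ j → ω (Pi.single i 1) (q j) = 0 := by
    intro i j hij
    exact (mul_eq_zero.1 (hdisj i j hij (q j))).resolve_right (hq j)
  let π : Equiv.Perm ι := Equiv.ofBijective q (Finite.injective_iff_bijective.1 hqinj)
  refine ⟨π, fun i => ω (Pi.single i 1) (q i), fun i => ?_, fun f i => ?_⟩
  · have h := hω (Pi.single i 1)
    rw [hsingle, ← Equiv.sum_comp π, Finset.sum_eq_single i] at h
    · exact h
    · intro j _ hj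
      change |ω (Pi.single i 1) (q j)| = 0
      rw [hzero i j hj.symm, abs_zero]
    · simp
  · have hs : ∀ j : ι, (fun k => if j = k then (1 : ℝ) else 0) = Pi.single j 1 := by
      intro j
      funext k
      simp [Pi.single_apply, eq_comm]
    rw [LinearMap.pi_apply_eq_sum_univ, Finset.sum_apply]
    simp only [hs, Pi.smul_apply, smul_eq_mul]
    rw [Finset.sum_eq_single i]
    · exact mul_comm _ _
    · intro j _ hj
      change f j * ω (Pi.single j 1) (q i) = 0
      rw [hzero j i hj, mul_zero]
    · simp

/-! ### Symmetries of the cycle space of a 3-connected graph -/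

namespace EdgeOrientation

variable {V : Type*} {G : SimpleGraph V} (O : EdgeOrientation G) [Fintype G.edgeSet]

theorem apply_mem_cycleSpace {ω : (G.edgeSet → ℝ) ≃ₗ[ℝ] (G.edgeSet → ℝ)} (hω : ω ∈ O.cyGroup)
    {z : G.edgeSet → ℝ} (hz : z ∈ O.cycleSpace ℝ) : ω z ∈ O.cycleSpace ℝ :=
  hω.2 ▸ Submodule.mem_map_of_mem (f := (ω : (G.edgeSet → ℝ) →ₗ[ℝ] (G.edgeSet → ℝ))) hz

theorem apply_mem_cutSpace {ω : (G.edgeSet → ℝ) ≃ₗ[ℝ] (G.edgeSet → ℝ)} (hω : ω ∈ O.cyGroup)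
    {b : G.edgeSet → ℝ} (hb : b ∈ O.cutSpace ℝ) : ω b ∈ O.cutSpace ℝ := by
  intro z hz
  obtain ⟨π, ε, hε, hπ⟩ := exists_signed_perm_of_l1_isometry ω.toLinearMap hω.1
  obtain ⟨y, hy, rfl⟩ : ∃ y ∈ O.cycleSpace ℝ, ω y = z :=
    ⟨ω⁻¹ z, O.apply_mem_cycleSpace (inv_mem hω) hz, ω.apply_symm_apply z⟩
  rw [← hb y hy, dotProduct, dotProduct, ← Equiv.sum_comp π]
  refine Finset.sum_congr rfl fun e _ => ?_
  have h1 : ω b (π e) = ε e * b e := hπ b e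
  have h2 : ω y (π e) = ε e * y e := hπ y e
  have h3 : ε e * ε e = 1 := by rw [← abs_mul_abs_self, hε, one_mul]
  rw [h1, h2]
  linear_combination b e * y e * h3

variable {O}

/-- In a 3-connected graph an element of the cut space supported on the edges at `v` is a multiple
of the cut around `v`. -/
theorem eq_smul_incidence_of_support (hconn : G.Preconnected) (hG : G.IsTwoInseparable) {v a : V}
    (ha : G.Adj v a) {b : G.edgeSet → ℝ} (hb : b ∈ O.cutSpace ℝ)
    (hv : ∀ e : G.edgeSet, b e ≠ 0 → v ∈ (e : Sym2 V)) : ∃ c : ℝ, b = c • O.incidence ℝ v := by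
  obtain ⟨p, hp⟩ := O.exists_potential hconn hb
  have hstep : ∀ x y, G.Adj x y → x ≠ v → y ≠ v → p x = p y := by
    intro x y hxy hx hy
    have h0 : b ⟨s(x, y), hxy⟩ = 0 := by
      by_contra h
      have := hv _ h
      rw [Sym2.mem_iff] at this
      rcases this with h | h
      exacts [hx h.symm, hy h.symm]
    rw [hp] at h0
    rcases Sym2.eq_iff.1 (O.mk_tail_head ⟨s(x, y), hxy⟩) with ⟨h1, h2⟩ | ⟨h1, h2⟩ <;>
      rw [h1, h2] at h0 <;> linarith
  have hconst : ∀ y, y ≠ v → p y = p a := by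
    intro y hy
    suffices h : ∀ y, Relation.ReflTransGen (G.AvoidAdj v v) a y → y ≠ v ∧ p y = p a from
      (h y (hG v v a y ha.ne' ha.ne' hy hy)).2
    intro y h
    induction h with
    | refl => exact ⟨ha.ne', rfl⟩
    | tail _ hbc ih => exact ⟨hbc.2.1, by rw [← hstep _ _ hbc.1 ih.1 hbc.2.1, ih.2]⟩
  refine ⟨p v - p a, funext fun e => ?_⟩
  rw [Pi.smul_apply, smul_eq_mul, hp]
  by_cases hh : O.head e = v
  · subst hh
    rw [O.incidence_head, hconst _ (O.head_ne_tail e).symm, mul_one]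
  by_cases ht : O.tail e = v
  · subst ht
    rw [O.incidence_tail, hconst _ (O.head_ne_tail e)]
    ring
  · have : O.incidence ℝ v e = 0 := by
      by_contra h
      rcases (O.mem_iff _ _).1 ((O.incidence_ne_zero_iff ℝ).1 h) with h | h
      exacts [ht h.symm, hh h.symm]
    rw [this, hconst _ hh, hconst _ ht]
    ring

/-- A symmetry of the cycle space of a 3-connected graph maps the cut around a vertex to a multiple
of the cut around some vertex. Let `p` be a potential of the image `b` of the cut around `v`. If
`b` is nonzero on all edges at some vertex `w`, then the preimage of the cut around `w` is
supported at `v`, and so is a multiple of the cut around `v`. Otherwise every vertex lies on an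
edge where `b` vanishes; as `b` vanishes only inside the level sets of `p`, every cycle in the zero
set of `b` splits along a level set, whereas the cycle matroid of `G - v` is connected. -/
theorem exists_apply_incidence_eq (hconn : G.Preconnected) (hG : G.IsTwoInseparable)
    (hdeg : ∀ v, ∃ a, G.Adj v a) {ω : (G.edgeSet → ℝ) ≃ₗ[ℝ] (G.edgeSet → ℝ)} (hω : ω ∈ O.cyGroup)
    (v : V) : ∃ (w : V) (c : ℝ), c ≠ 0 ∧ ω (O.incidence ℝ v) = c • O.incidence ℝ w := by
  classical
  obtain ⟨π, ε, hε, hπ'⟩ := exists_signed_perm_of_l1_isometry ω.toLinearMap hω.1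
  have hπ : ∀ f e, ω f (π e) = ε e * f e := hπ'
  have hε0 : ∀ e, ε e ≠ 0 := fun e h => by simpa [h] using hε e
  have hsupp : ∀ f e, ω f (π e) ≠ 0 ↔ f e ≠ 0 := fun f e => by simp [hπ, hε0]
  set b := ω (O.incidence ℝ v) with hb
  have hbv : ∀ e, b (π e) ≠ 0 ↔ v ∈ (e : Sym2 V) := fun e => by
    rw [hb, hsupp, O.incidence_ne_zero_iff]
  have hbcut : b ∈ O.cutSpace ℝ := O.apply_mem_cutSpace hω (O.incidence_mem_cutSpace ℝ v)
  by_cases hw : ∃ w, ∀ e : G.edgeSet, w ∈ (e : Sym2 V) → b e ≠ 0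
  · obtain ⟨w, hw⟩ := hw
    obtain ⟨a, ha⟩ := hdeg v
    have happ : ω (ω⁻¹ (O.incidence ℝ w)) = O.incidence ℝ w := ω.apply_symm_apply _
    obtain ⟨c, hc⟩ := eq_smul_incidence_of_support hconn hG ha
      (O.apply_mem_cutSpace (inv_mem hω) (O.incidence_mem_cutSpace ℝ w)) (fun e he => by
        rw [← hsupp, happ, O.incidence_ne_zero_iff] at he
        exact (hbv e).1 (hw _ he))
    have hcb : O.incidence ℝ w = c • b := by rw [← happ, hc, map_smul]
    have hc0 : c ≠ 0 := by
      rintro rfl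
      obtain ⟨a', ha'⟩ := hdeg w
      have h := (O.incidence_ne_zero_iff ℝ (e := ⟨s(w, a'), ha'⟩) (v := w)).2 (by simp)
      rw [hcb, zero_smul] at h
      exact h rfl
    exact ⟨w, c⁻¹, inv_ne_zero hc0, by rw [hcb, smul_smul, inv_mul_cancel₀ hc0, one_smul]⟩
  · push Not at hw
    exfalso
    obtain ⟨p, hp⟩ := O.exists_potential hconn hbcut
    obtain ⟨e₁, hve₁, he₁⟩ := hw v
    -- The level set of `p` through `v` splits the zero set of `b`.
    have hK : ∀ z ∈ O.cycleSpace ℝ, (∀ e : G.edgeSet, z e ≠ 0 → v ∉ (e : Sym2 V)) →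
        (fun e => if e ∈ {e | p (O.head (π e)) = p v} then z e else 0) ∈ O.cycleSpace ℝ := by
      intro z hz hzv
      have h1 := O.indicator_mem_cycleSpace (fun x => p x = p v) (O.apply_mem_cycleSpace hω hz) (by
        intro e he
        obtain ⟨e, rfl⟩ := π.surjective e
        rw [hsupp] at he
        have h2 := hp (π e)
        have h3 : b (π e) = 0 := by
          by_contra h
          exact hzv e he ((hbv e).1 h)
        rw [h3] at h2
        rw [show p (O.head (π e)) = p (O.tail (π e)) by linarith])
      have h2 := O.apply_mem_cycleSpace (inv_mem hω) h1
      have happ : ∀ f, ω (ω⁻¹ f) = f := fun f => ω.apply_symm_apply f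
      refine Eq.subst (motive := (· ∈ O.cycleSpace ℝ)) ?_ h2
      apply ω.injective
      rw [happ]
      funext e
      obtain ⟨e, rfl⟩ := π.surjective e
      simp only [hπ, Set.mem_ofPred_eq]
      split_ifs <;> simp
    have hmem : ∀ e' : G.edgeSet, b e' = 0 → p (O.head e') = p v := by
      intro e' he'
      have h1 : p (O.head e₁) = p v := by
        rw [O.mem_iff] at hve₁
        have := hp e₁
        rw [he₁] at this
        rcases hve₁ with h | h
        · rw [h]
          linarith
        · rw [h]
      obtain ⟨e, rfl⟩ := π.surjective e'
      obtain ⟨e₁, rfl⟩ := π.surjective e₁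
      exact O.mem_of_forall_indicator_mem hG v {e | p (O.head (π e)) = p v} hK (e₁ := e₁) h1
        (fun h => (hbv e₁).2 h he₁) (fun h => (hbv e).2 h he')
    have hconst : ∀ w, p w = p v := by
      intro w
      obtain ⟨e, hwe, he⟩ := hw w
      rw [← hmem e he]
      have := hp e
      rw [O.mem_iff] at hwe
      rw [he] at this
      rcases hwe with h | h
      · rw [h]
        linarith
      · rw [h]
    obtain ⟨a, ha⟩ := hdeg v
    refine (hbv ⟨s(v, a), ha⟩).2 (by simp) ?_
    rw [hp, hconst, hconst (O.tail _), sub_self]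

/-- **Whitney's theorem** for 3-connected graphs: every symmetry of the cycle space is, up to a
scalar, induced by an automorphism of the graph. -/
theorem exists_eq_smul_edgeRep (hconn : G.Preconnected) (hG : G.IsTwoInseparable) [Finite V]
    (hdeg : ∀ v w, ∃ a, a ≠ w ∧ G.Adj v a) {ω : (G.edgeSet → ℝ) ≃ₗ[ℝ] (G.edgeSet → ℝ)}
    (hω : ω ∈ O.cyGroup) :
    ∃ (φ : G ≃g G) (c : ℝ), ∀ f, ω f = c • O.edgeRep ℝ φ f := by
  obtain ⟨π, ε, hε, hπ'⟩ := exists_signed_perm_of_l1_isometry ω.toLinearMap hω.1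
  have hπ : ∀ f e, ω f (π e) = ε e * f e := hπ'
  have hε0 : ∀ e, ε e ≠ 0 := fun e h => by simpa [h] using hε e
  choose φ c hc hφ using exists_apply_incidence_eq (O := O) hconn hG
    (fun v => (hdeg v v).imp fun _ h => h.2) hω
  have key : ∀ v e, c v * O.incidence ℝ (φ v) (π e) = ε e * O.incidence ℝ v e := fun v e => by
    rw [← hπ, hφ, Pi.smul_apply, smul_eq_mul]
  have hmem : ∀ v (e : G.edgeSet), φ v ∈ (π e : Sym2 V) ↔ v ∈ (e : Sym2 V) := by
    intro v e
    rw [← O.incidence_ne_zero_iff ℝ, ← O.incidence_ne_zero_iff ℝ (e := e), not_iff_not]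
    have := key v e
    constructor
    · intro h
      rw [h, mul_zero] at this
      exact (mul_eq_zero.1 this.symm).resolve_left (hε0 e)
    · intro h
      rw [h, mul_zero] at this
      exact (mul_eq_zero.1 this).resolve_left (hc v)
  have hinj : Function.Injective φ := by
    intro v w hvw
    by_contra hne
    obtain ⟨a, haw, hva⟩ := hdeg v w
    have h1 := (hmem v ⟨s(v, a), hva⟩).2 (by simp)
    rw [hvw, hmem, Sym2.mem_iff] at h1
    rcases h1 with h1 | h1
    exacts [hne h1.symm, haw h1.symm]
  have hedge : ∀ (e : G.edgeSet) v w, (e : Sym2 V) = s(v, w) → (π e : Sym2 V) = s(φ v, φ w) := by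
    intro e v w he
    have hvw : G.Adj v w := by rw [← SimpleGraph.mem_edgeSet, ← he]; exact e.2
    exact (Sym2.mem_and_mem_iff (hinj.ne hvw.ne)).1
      ⟨(hmem v e).2 (by simp [he]), (hmem w e).2 (by simp [he])⟩
  let ψ : G ≃g G :=
    { toEquiv := Equiv.ofBijective φ (Finite.injective_iff_bijective.1 hinj)
      map_rel_iff' := by
        intro v w
        change G.Adj (φ v) (φ w) ↔ G.Adj v w
        constructor
        · intro h
          obtain ⟨e, he⟩ := π.surjective ⟨s(φ v, φ w), h⟩
          have hne : v ≠ w := fun h' => h.ne (by rw [h'])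
          have h1 : (e : Sym2 V) = s(v, w) := (Sym2.mem_and_mem_iff hne).1
            ⟨(hmem v e).1 (by simp [he]), (hmem w e).1 (by simp [he])⟩
          rw [← SimpleGraph.mem_edgeSet, ← h1]
          exact e.2
        · intro h
          rw [← SimpleGraph.mem_edgeSet, ← hedge ⟨s(v, w), h⟩ v w rfl]
          exact (π _).2 }
  have hψ : ∀ v, ψ v = φ v := fun _ => rfl
  have hψe : ∀ e, ψ.mapEdgeSet e = π e := by
    intro e
    apply Subtype.ext
    rw [hedge e _ _ (O.mk_tail_head e).symm]
    change Sym2.map ψ (e : Sym2 V) = _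
    rw [← O.mk_tail_head e, Sym2.map_mk]
    rfl
  have hsign : ∀ v e, O.incidence ℝ (φ v) (π e) = O.sign ℝ ψ e * O.incidence ℝ v e := fun v e => by
    rw [← hψe, ← hψ, O.incidence_map]
  -- Both ends of an edge have the same scalar, since the two cuts have opposite values on it.
  have hce : ∀ e : G.edgeSet, c (O.head e) * O.sign ℝ ψ e = ε e ∧
      c (O.tail e) * O.sign ℝ ψ e = ε e := by
    intro e
    have h1 := key (O.head e) e
    have h2 := key (O.tail e) e
    rw [hsign, O.incidence_head] at h1
    rw [hsign, O.incidence_tail] at h2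
    constructor <;> linarith
  have hadj : ∀ v w, G.Adj v w → c v = c w := by
    intro v w h
    obtain ⟨h1, h2⟩ := hce ⟨s(v, w), h⟩
    have h0 : O.sign ℝ ψ ⟨s(v, w), h⟩ ≠ 0 := by
      intro h0
      rw [h0, mul_zero] at h1
      exact hε0 _ h1.symm
    have h3 := mul_right_cancel₀ h0 (h1.trans h2.symm)
    rcases Sym2.eq_iff.1 (O.mk_tail_head ⟨s(v, w), h⟩) with ⟨h4, h5⟩ | ⟨h4, h5⟩ <;>
      rw [h4, h5] at h3
    exacts [h3.symm, h3]
  rcases isEmpty_or_nonempty V with hV | ⟨⟨x₀⟩⟩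
  · exact ⟨1, 0, fun f => funext fun e => isEmptyElim (O.head e)⟩
  have hconst : ∀ v, c v = c x₀ := by
    intro v
    have h := (SimpleGraph.reachable_iff_reflTransGen x₀ v).1 (hconn x₀ v)
    induction h with
    | refl => rfl
    | tail _ h ih => rw [← hadj _ _ h, ih]
  refine ⟨ψ, c x₀, fun f => funext fun e => ?_⟩
  obtain ⟨e, rfl⟩ := π.surjective e
  have hinv : ψ⁻¹.mapEdgeSet (π e) = e := by
    rw [← hψe, ← mapEdgeSet_mul, inv_mul_cancel, mapEdgeSet_one]
  have h1 := O.sign_mul ℝ ψ ψ⁻¹ (π e)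
  rw [mul_inv_cancel, sign_one, hinv] at h1
  rw [hπ, Pi.smul_apply, smul_eq_mul, edgeRep_apply, hinv, ← (hce e).1, hconst]
  have h2 : O.sign ℝ ψ e * O.sign ℝ ψ e = 1 := by
    unfold sign
    split_ifs <;> simp
  linear_combination (c x₀ * f e * O.sign ℝ ψ⁻¹ (π e)) * h2 + c x₀ * f e * O.sign ℝ ψ e * h1

end EdgeOrientation

/-! ### Cayley graphs that are graphical regular representations -/

section Cayley

variable {Γ : Type*} [Group Γ] {X : Set Γ} {hinv : X⁻¹ = X} {hone : (1 : Γ) ∉ X}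

theorem rightCayley_adj {g h : Γ} : (rightCayley X hinv hone).Adj g h ↔ h * g⁻¹ ∈ X := Iff.rfl

theorem rightTranslation_apply (a g : Γ) : rightTranslation X hinv hone a g = g * a⁻¹ := rfl

theorem rightTranslation_inv_apply (a g : Γ) :
    (rightTranslation X hinv hone a)⁻¹ g = g * a := by
  rw [← map_inv, rightTranslation_apply, inv_inv]

theorem rightCayley_preconnected (hgen : Subgroup.closure X = ⊤) :
    (rightCayley X hinv hone).Preconnected := by
  have h : ∀ g, (rightCayley X hinv hone).Reachable 1 g := by
    intro g
    have hg : g ∈ Subgroup.closure X := hgen ▸ Subgroup.mem_top g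
    have hmul : ∀ x ∈ X, ∀ y, (rightCayley X hinv hone).Reachable y (x * y) := fun x hx y =>
      SimpleGraph.Adj.reachable (rightCayley_adj.2 (by simpa using hx))
    induction hg using Subgroup.closure_induction_left with
    | one => exact .refl _
    | mul_left x hx y _ ih => exact ih.trans (hmul x hx y)
    | inv_mul_cancel x hx y _ ih =>
      exact ih.trans (hmul x⁻¹ (by rw [← Set.mem_inv, hinv]; exact hx) y)
  exact fun x y => (h x).symm.trans (h y)

theorem rightCayley_vertexTransitive (x y : Γ) :
    ∃ φ : rightCayley X hinv hone ≃g rightCayley X hinv hone, φ x = y :=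
  ⟨rightTranslation X hinv hone (y⁻¹ * x), by rw [rightTranslation_apply]; group⟩

theorem ncard_neighborSet_rightCayley (g : Γ) :
    ((rightCayley X hinv hone).neighborSet g).ncard = X.ncard := by
  rw [← Set.ncard_image_of_injective X (mul_left_injective g)]
  congr 1
  ext h
  rw [SimpleGraph.mem_neighborSet, rightCayley_adj, Set.mem_image]
  exact ⟨fun hh => ⟨_, hh, by simp⟩, by rintro ⟨x, hx, rfl⟩; simpa using hx⟩

/-- In a graphical regular representation an involutive automorphism fixing `1` is trivial. -/
theorem eq_self_of_involutive (hGRR : ∀ φ : rightCayley X hinv hone ≃g rightCayley X hinv hone,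
      ∃ a : Γ, ∀ g : Γ, φ g = g * a) {f : Γ → Γ} (hf : Function.Involutive f) (h1 : f 1 = 1)
    (hadj : ∀ z ∈ X, ∀ g, f (z * g) * (f g)⁻¹ ∈ X) (g : Γ) : f g = g := by
  have hmap : ∀ g h : Γ, h * g⁻¹ ∈ X → f h * (f g)⁻¹ ∈ X := fun g h hh => by
    simpa using hadj _ hh g
  obtain ⟨a, ha⟩ := hGRR
    { toEquiv := hf.toPerm
      map_rel_iff' := by
        intro g h
        refine ⟨fun hh => ?_, hmap g h⟩
        have := hmap _ _ hh
        rwa [Function.Involutive.coe_toPerm, hf, hf] at this }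
  have ha' : ∀ g, f g = g * a := ha
  have : a = 1 := by rw [← one_mul a, ← ha', h1]
  rw [ha', this, mul_one]

theorem inv_eq_self_of_commute (hGRR : ∀ φ : rightCayley X hinv hone ≃g rightCayley X hinv hone,
      ∃ a : Γ, ∀ g : Γ, φ g = g * a) (hcomm : ∀ a b : Γ, a * b = b * a) (g : Γ) : g⁻¹ = g :=
  eq_self_of_involutive hGRR inv_involutive inv_one (fun z hz g => by
    rw [mul_inv_rev, hcomm g⁻¹, mul_inv_cancel_right, ← Set.mem_inv, hinv]
    exact hz) g

/-- A cycle is not a graphical regular representation. If the connection set is `{x, x⁻¹}`, then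
the group is cyclic and inversion is an additional automorphism; if it consists of two involutions
`x` and `y`, then the group is dihedral and the automorphism that exchanges `x` and `y` is an
additional one. -/
theorem three_le_ncard [Finite Γ] (hcard : 2 < Nat.card Γ) (hgen : Subgroup.closure X = ⊤)
    (hGRR : ∀ φ : rightCayley X hinv hone ≃g rightCayley X hinv hone,
      ∃ a : Γ, ∀ g : Γ, φ g = g * a) : 3 ≤ X.ncard := by
  classical
  have hcyc : ∀ r : Γ, (∀ g, g ∈ Subgroup.zpowers r) → r⁻¹ = r → False := by
    intro r hr hr'
    have h1 : Nat.card Γ = orderOf r := by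
      rw [← Nat.card_zpowers, (Subgroup.eq_top_iff' _).2 hr, Subgroup.card_top]
    have h2 : orderOf r ≤ 2 := orderOf_le_of_pow_eq_one (by norm_num) (by
      rw [sq, mul_eq_one_iff_eq_inv, hr'])
    omega
  have hcomm : ∀ r : Γ, (∀ g, g ∈ Subgroup.zpowers r) → ∀ a b : Γ, a * b = b * a := by
    intro r hr a b
    obtain ⟨m, rfl⟩ := hr a
    obtain ⟨n, rfl⟩ := hr b
    exact zpow_mul_comm r m n
  have hcyc' : ∀ r : Γ, ¬ ∀ g, g ∈ Subgroup.zpowers r := fun r hr =>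
    hcyc r hr (inv_eq_self_of_commute hGRR (hcomm r hr) r)
  by_contra! hlt
  have hX : X.Finite := Set.toFinite X
  obtain h0 | h1 | h2 : X.ncard = 0 ∨ X.ncard = 1 ∨ X.ncard = 2 := by omega
  · rw [Set.ncard_eq_zero hX] at h0
    rw [h0, Subgroup.closure_empty] at hgen
    exact hcyc' 1 fun g => by
      have hg : g ∈ (⊥ : Subgroup Γ) := hgen ▸ Subgroup.mem_top g
      simpa using hg
  · obtain ⟨x, rfl⟩ := Set.ncard_eq_one.1 h1
    exact hcyc' x fun g => by
      rw [Subgroup.zpowers_eq_closure, hgen]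
      exact Subgroup.mem_top g
  · obtain ⟨x, y, hxy, rfl⟩ := Set.ncard_eq_two.1 h2
    have hxi : x⁻¹ = x ∨ x⁻¹ = y := by
      have h : x⁻¹ ∈ ({x, y} : Set Γ) := by rw [← Set.mem_inv, hinv]; simp
      simpa using h
    have hyi : y⁻¹ = x ∨ y⁻¹ = y := by
      have h : y⁻¹ ∈ ({x, y} : Set Γ) := by rw [← Set.mem_inv, hinv]; simp
      simpa using h
    rcases hxi with hx | rfl
    swap
    · refine hcyc' x fun g => ?_
      have hle : Subgroup.closure {x, x⁻¹} ≤ Subgroup.zpowers x := by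
        rw [Subgroup.closure_le]
        rintro _ (rfl | rfl)
        exacts [Subgroup.mem_zpowers _, inv_mem (Subgroup.mem_zpowers _)]
      exact hle (hgen ▸ Subgroup.mem_top g)
    have hy : y⁻¹ = y := hyi.resolve_left fun h => hxy (by rw [← hx, ← h, inv_inv])
    have hxx : x * x = 1 := by rw [mul_eq_one_iff_eq_inv, hx]
    have hyy : y * y = 1 := by rw [mul_eq_one_iff_eq_inv, hy]
    have hxx' : ∀ g, x * (x * g) = g := fun g => by rw [← mul_assoc, hxx, one_mul]
    have hyy' : ∀ g, y * (y * g) = g := fun g => by rw [← mul_assoc, hyy, one_mul]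
    set R := Subgroup.zpowers (x * y) with hR
    have hr : x * y ∈ R := Subgroup.mem_zpowers _
    have hr' : y * x ∈ R := by
      have := inv_mem hr
      rwa [mul_inv_rev, hx, hy] at this
    -- The generators `x` and `y` invert the rotations.
    have hconj_x : ∀ h ∈ R, x * h * x = h⁻¹ := by
      rintro _ ⟨n, rfl⟩
      have : MulAut.conj x (x * y) = (x * y)⁻¹ := by
        rw [MulAut.conj_apply, mul_inv_rev, hx, hy, hxx']
      have h := map_zpow (MulAut.conj x) (x * y) n
      rw [this, MulAut.conj_apply, hx, inv_zpow] at h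
      exact h
    have hconj_y : ∀ h ∈ R, y * h * y = h⁻¹ := by
      rintro _ ⟨n, rfl⟩
      have : MulAut.conj y (x * y) = (x * y)⁻¹ := by
        rw [MulAut.conj_apply, mul_inv_rev, hx, hy, mul_assoc, mul_assoc, hyy, mul_one]
      have h := map_zpow (MulAut.conj y) (x * y) n
      rw [this, MulAut.conj_apply, hy, inv_zpow] at h
      exact h
    have hx_mul : ∀ h ∈ R, h * x * h = x := fun h hh => by
      have := hconj_x _ hh
      calc h * x * h = x * (x * h * x) * h := by simp only [mul_assoc, hxx']
        _ = x := by rw [this]; group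
    have hy_mul : ∀ h ∈ R, h * y * h = y := fun h hh => by
      have := hconj_y _ hh
      calc h * y * h = y * (y * h * y) * h := by simp only [mul_assoc, hyy']
        _ = y := by rw [this]; group
    have hcover : ∀ g, g ∈ R ∨ x * g ∈ R := by
      intro g
      have hg : g ∈ Subgroup.closure {x, y} := hgen ▸ Subgroup.mem_top g
      have hstep : ∀ z ∈ ({x, y} : Set Γ), ∀ g, g ∈ R ∨ x * g ∈ R →
          z * g ∈ R ∨ x * (z * g) ∈ R := by
        rintro z (rfl | rfl) g (h | h)
        · exact Or.inr (by rwa [hxx'])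
        · exact Or.inl h
        · exact Or.inr (by rw [← mul_assoc]; exact mul_mem hr h)
        · refine Or.inl ?_
          have := mul_mem hr' h
          rwa [mul_assoc, hxx'] at this
      induction hg using Subgroup.closure_induction_left with
      | one => exact Or.inl (one_mem R)
      | mul_left z hz g _ ih => exact hstep z hz g ih
      | inv_mul_cancel z hz g _ ih =>
        refine hstep z⁻¹ ?_ g ih
        rwa [← Set.mem_inv, hinv]
    have hxR : x ∉ R := by
      intro hxR
      refine hcyc' (x * y) fun g => (hcover g).elim id fun h => ?_
      have := mul_mem hxR h
      rwa [hxx'] at this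
    have hyR : y ∉ R := fun h => hxR (by
      have := mul_mem hr h
      rwa [mul_assoc, hyy, mul_one] at this)
    -- The group automorphism exchanging `x` and `y`; it sends the reflection `x h` to `h y`.
    let f : Γ → Γ := fun g => if g ∈ R then g⁻¹ else x * g * y
    have hfR : ∀ g ∈ R, f g = g⁻¹ := fun g hg => if_pos hg
    have hfR' : ∀ g, g ∉ R → f g = x * g * y := fun g hg => if_neg hg
    have hrefl : ∀ z ∈ ({x, y} : Set Γ), ∀ h ∈ R, z * h ∉ R := by
      rintro z (rfl | rfl) h hh hz
      · exact hxR ((mul_mem_cancel_right hh).1 hz)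
      · exact hyR ((mul_mem_cancel_right hh).1 hz)
    have hf : Function.Involutive f := by
      intro g
      by_cases hg : g ∈ R
      · rw [hfR g hg, hfR _ (inv_mem hg), inv_inv]
      · have h := (hcover g).resolve_left hg
        rw [hfR' g hg, hfR']
        · rw [mul_assoc, mul_assoc, mul_assoc, hyy, mul_one, hxx']
        · exact fun h' => hyR ((mul_mem_cancel_left h).1 h')
    refine hxy ?_
    have hfx := eq_self_of_involutive hGRR hf (by rw [hfR 1 (one_mem R), inv_one]) ?_ x
    · rw [hfR' x hxR, hxx, one_mul] at hfx
      exact hfx.symm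
    · intro z hz g
      by_cases hg : g ∈ R
      · rw [hfR g hg, hfR' _ (hrefl z hz g hg), inv_inv]
        rcases hz with rfl | rfl
        · rw [hxx', hy_mul g hg]
          simp
        · have : x * (z * g) * z * g = x * z * (g * z * g) := by group
          rw [this, hy_mul g hg, mul_assoc, hyy, mul_one]
          simp
      · obtain ⟨h, hh, rfl⟩ : ∃ h ∈ R, g = x * h :=
          ⟨x * g, (hcover g).resolve_left hg, (hxx' g).symm⟩
        have hzg : z * (x * h) ∈ R := by
          rcases hz with rfl | rfl
          · rwa [hxx']
          · rw [← mul_assoc]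
            exact mul_mem hr' hh
        rw [hfR' _ hg, hfR _ hzg, hxx']
        simp only [mul_inv_rev, hx, hy]
        rcases hz with rfl | rfl
        · rw [hx, mul_assoc h⁻¹ z z, hxx, mul_one, ← mul_assoc, hy_mul _ (inv_mem hh)]
          simp
        · rw [hy, ← mul_assoc, mul_assoc _ z z, hyy, mul_one, hx_mul _ (inv_mem hh)]
          simp

end Cayley

/-! ### Nontrivial constituents of representations -/

theorem Representation.sum_apply_apply_eq {k Γ V : Type*} [Field k] [Group Γ] [Fintype Γ]
    [AddCommGroup V] [Module k V] (ρ : Representation k Γ V) (a : Γ) (v : V) :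
    ∑ g, ρ g (ρ a v) = ∑ g, ρ g v := by
  rw [← Equiv.sum_comp (Equiv.mulRight a) fun g => ρ g v]
  refine Finset.sum_congr rfl fun g _ => ?_
  rw [Equiv.coe_mulRight, map_mul, Module.End.mul_apply]

/-- A nontrivial finite-dimensional representation of a finite group in characteristic zero has a
nontrivial irreducible subrepresentation: a minimal nonzero subrepresentation of the kernel of
averaging, where no nonzero vector is fixed. -/
theorem Representation.exists_isIrreducible_not_isTrivial {k Γ V : Type*} [Field k] [CharZero k]
    [Group Γ] [Finite Γ] [AddCommGroup V] [Module k V] [FiniteDimensional k V]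
    (ρ : Representation k Γ V) {a : Γ} {v : V} (hv : ρ a v ≠ v) :
    ∃ U : Subrepresentation ρ, IsIrreducible (V := U.toSubmodule) U.toRepresentation ∧
      ¬ U.toRepresentation.IsTrivial := by
  classical
  cases nonempty_fintype Γ
  let S : Submodule k V := LinearMap.ker (∑ g, ρ g)
  have hS : ∀ w, w ∈ S ↔ ∑ g, ρ g w = 0 := fun w => by
    rw [LinearMap.mem_ker, LinearMap.sum_apply]
  let N : Subrepresentation ρ := ⟨S, fun g w hw => by
    rw [hS, sum_apply_apply_eq]
    exact (hS w).1 hw⟩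
  have hN : N.toSubmodule ≠ ⊥ ∧ N.toSubmodule ≤ S := by
    refine ⟨fun h => hv ?_, le_rfl⟩
    have : ρ a v - v ∈ S := by
      rw [hS]
      simp only [map_sub, Finset.sum_sub_distrib, sum_apply_apply_eq, sub_self]
    rw [show S = ⊥ from h, Submodule.mem_bot, sub_eq_zero] at this
    exact this
  obtain ⟨U, ⟨hU, hUS⟩, hmin⟩ := exists_minimalFor_of_wellFoundedLT
    (fun M : Subrepresentation ρ => M.toSubmodule ≠ ⊥ ∧ M.toSubmodule ≤ S)
    (fun M => M.toSubmodule) ⟨N, hN⟩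
  obtain ⟨u, huU, hu⟩ := Submodule.exists_mem_ne_zero_of_ne_bot hU
  refine ⟨U, ?_, fun htriv => hu ?_⟩
  · have hnt : Nontrivial (Subrepresentation (W := U.toSubmodule) U.toRepresentation) := by
      refine ⟨⊥, ⊤, fun h => ?_⟩
      have : (⊥ : Submodule k U.toSubmodule) = ⊤ :=
        congrArg Subrepresentation.toSubmodule h
      have h1 : (⟨u, huU⟩ : U.toSubmodule) ∈ (⊥ : Submodule k U.toSubmodule) :=
        this ▸ Submodule.mem_top
      rw [Submodule.mem_bot, Subtype.ext_iff] at h1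
      exact hu h1
    refine { hnt with eq_bot_or_eq_top := fun W => ?_ }
    let W' : Subrepresentation ρ := ⟨W.toSubmodule.map U.toSubmodule.subtype, by
      rintro g _ ⟨w, hw, rfl⟩
      exact ⟨_, W.apply_mem_toSubmodule g hw, rfl⟩⟩
    have hW' : W'.toSubmodule ≤ U.toSubmodule := Submodule.map_subtype_le _ _
    by_cases hW : W.toSubmodule = ⊥
    · exact Or.inl (Subrepresentation.toSubmodule_injective hW)
    · refine Or.inr (Subrepresentation.toSubmodule_injective (Submodule.eq_top_iff'.2 fun x => ?_))
      have hle := hmin (j := W') ⟨fun h => hW ?_, hW'.trans hUS⟩ hW'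
      · obtain ⟨w, hw, hwx⟩ := hle x.2
        rwa [← (Subtype.ext hwx : w = x)]
      · exact Submodule.map_injective_of_injective (Submodule.subtype_injective _)
          (h.trans (Submodule.map_bot _).symm)
  · have h1 := (hS u).1 (hUS huU)
    have h2 : ∀ g, ρ g u = u := fun g =>
      congrArg Subtype.val (U.toRepresentation.isTrivial_apply g ⟨u, huU⟩)
    simp only [h2, Finset.sum_const, Finset.card_univ] at h1
    rw [← Nat.cast_smul_eq_nsmul k, smul_eq_zero] at h1
    exact h1.resolve_left (Nat.cast_ne_zero.2 Fintype.card_ne_zero)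

/-! ### Coboundaries -/

namespace EdgeOrientation

variable {V : Type*} {G : SimpleGraph V} (O : EdgeOrientation G)

open scoped Matrix

theorem mulVec_edgeRep [Fintype G.edgeSet] (𝕜 : Type*) [Field 𝕜] (φ : G ≃g G) (f : G.edgeSet → 𝕜)
    (v : V) : (O.incidence 𝕜 *ᵥ O.edgeRep 𝕜 φ f) v = (O.incidence 𝕜 *ᵥ f) (φ⁻¹ v) := by
  simp only [Matrix.mulVec, dotProduct]
  refine Fintype.sum_equiv (φ⁻¹).mapEdgeSet _ _ fun e => ?_
  rw [incidence_map, edgeRep_apply]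
  ring

variable (𝕜 : Type*) [Field 𝕜]

/-- The coboundary of a function on the vertices: its difference along each edge. -/
def coboundary : (V → 𝕜) →ₗ[𝕜] (G.edgeSet → 𝕜) where
  toFun p e := p (O.head e) - p (O.tail e)
  map_add' p q := by
    funext e
    simp only [Pi.add_apply]
    ring
  map_smul' c p := by
    funext e
    simp only [Pi.smul_apply, smul_eq_mul, RingHom.id_apply]
    ring

theorem coboundary_apply (p : V → 𝕜) (e : G.edgeSet) :
    O.coboundary 𝕜 p e = p (O.head e) - p (O.tail e) := rfl

theorem coboundary_mem_cutSpace [Finite V] [Fintype G.edgeSet] (p : V → 𝕜) :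
    O.coboundary 𝕜 p ∈ O.cutSpace 𝕜 := by
  classical
  cases nonempty_fintype V
  have h : O.coboundary 𝕜 p = p ᵥ* O.incidence 𝕜 := by
    funext e
    simp only [Matrix.vecMul, dotProduct, O.incidence_apply, coboundary_apply, Pi.sub_apply,
      mul_sub, Finset.sum_sub_distrib, Pi.single_apply]
    simp
  intro z hz
  rw [h, ← Matrix.dotProduct_mulVec, O.mem_cycleSpace.1 hz, dotProduct_zero]

theorem edgeRep_coboundary (φ : G ≃g G) (p : V → 𝕜) :
    O.edgeRep 𝕜 φ (O.coboundary 𝕜 p) = O.coboundary 𝕜 fun v => p (φ⁻¹ v) := by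
  funext e
  rw [edgeRep_apply, coboundary_apply, coboundary_apply]
  rcases O.map_cases φ⁻¹ e with ⟨h, h'⟩ | ⟨h, h'⟩
  · rw [sign, if_pos h, h, h', one_mul]
  · rw [sign, if_neg (fun h'' => O.head_ne_tail _ (h''.symm.trans h)), h, h']
    ring

variable {𝕜} in
theorem eq_of_coboundary_eq_zero (hconn : G.Preconnected) {p : V → 𝕜}
    (hp : O.coboundary 𝕜 p = 0) (x y : V) : p x = p y := by
  have h := (SimpleGraph.reachable_iff_reflTransGen x y).1 (hconn x y)
  induction h with
  | refl => rfl
  | @tail b c _ h ih =>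
    have h1 := congrFun hp ⟨s(b, c), h⟩
    rw [coboundary_apply, Pi.zero_apply, sub_eq_zero] at h1
    rw [ih]
    rcases Sym2.eq_iff.1 (O.mk_tail_head ⟨s(b, c), h⟩) with ⟨h2, h3⟩ | ⟨h2, h3⟩ <;>
      rw [h2, h3] at h1
    exacts [h1.symm, h1]

end EdgeOrientation

/-! ### The cut space and the cycle space as representations of the group -/

section CayleyRepresentation

variable {Γ : Type*} [Group Γ] {X : Set Γ} {hinv : X⁻¹ = X} {hone : (1 : Γ) ∉ X}
  [Fintype (rightCayley X hinv hone).edgeSet] (O : EdgeOrientation (rightCayley X hinv hone))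

open scoped Matrix

/-- Every nontrivial irreducible representation embeds into the cut space: the matrix coefficients
`g ↦ ℓ (σ g w)` embed it into the functions on the group, and the coboundary kills only
constants. -/
theorem exists_injective_intertwiningMap_cutRep [Finite Γ] (hgen : Subgroup.closure X = ⊤)
    {𝕜 W : Type*} [Field 𝕜] [AddCommGroup W] [Module 𝕜 W] (σ : Representation 𝕜 Γ W)
    (hirr : σ.IsIrreducible) (hσ : ¬ σ.IsTrivial) :
    ∃ T : Representation.IntertwiningMap σ
      ((O.cutRep 𝕜).comp (rightTranslation X hinv hone)), Function.Injective T := by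
  obtain ⟨g, w, hgw⟩ : ∃ g w, σ g w ≠ w := by
    by_contra! h
    exact hσ ⟨fun g => LinearMap.ext fun w => h g w⟩
  obtain ⟨l, hl⟩ : ∃ l : Module.Dual 𝕜 W, l (σ g w - w) ≠ 0 := by
    by_contra! h
    exact hgw (sub_eq_zero.1 ((Module.forall_dual_apply_eq_zero_iff 𝕜 _).1 h))
  let L : W →ₗ[𝕜] O.cutSpace 𝕜 := LinearMap.codRestrict (O.cutSpace 𝕜)
    (O.coboundary 𝕜 ∘ₗ LinearMap.pi fun g => l ∘ₗ σ g) fun w => O.coboundary_mem_cutSpace 𝕜 _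
  have hL : ∀ w, (L w : (rightCayley X hinv hone).edgeSet → 𝕜) =
    O.coboundary 𝕜 fun g => l (σ g w) := fun _ => rfl
  let T : Representation.IntertwiningMap σ ((O.cutRep 𝕜).comp (rightTranslation X hinv hone)) :=
    LinearMap.intertwiningMap_of_isIntertwiningMap _ _ L (by
      intro a w
      apply Subtype.ext
      change _ = O.edgeRep 𝕜 (rightTranslation X hinv hone a) (L w)
      rw [hL, hL, O.edgeRep_coboundary]
      congr 1
      funext g
      rw [rightTranslation_inv_apply, map_mul, Module.End.mul_apply])
  refine ⟨T, (Representation.IsIrreducible.injective_or_eq_zero T).resolve_right fun h => hl ?_⟩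
  have h1 : L w = 0 := congrArg (fun T => T w) h
  have h2 := O.eq_of_coboundary_eq_zero (rightCayley_preconnected hgen)
    ((hL w).symm.trans (congrArg Subtype.val h1)) g 1
  rw [map_sub, h2, map_one, Module.End.one_apply, sub_self]

/-- The cut space has no nonzero fixed vector: the potential of a fixed vector changes by a
constant under each translation, and the constant is zero because the group is finite. -/
theorem eq_zero_of_edgeRep_eq_self [Finite Γ] (hgen : Subgroup.closure X = ⊤) {𝕜 : Type*}
    [Field 𝕜] [CharZero 𝕜] {b : (rightCayley X hinv hone).edgeSet → 𝕜} (hb : b ∈ O.cutSpace 𝕜)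
    (hfix : ∀ a, O.edgeRep 𝕜 (rightTranslation X hinv hone a) b = b) : b = 0 := by
  cases nonempty_fintype Γ
  have hconn := rightCayley_preconnected (hinv := hinv) (hone := hone) hgen
  obtain ⟨p, hp⟩ := O.exists_potential hconn hb
  obtain rfl : b = O.coboundary 𝕜 p := funext hp
  have hconst : ∀ a, p a = p 1 := by
    intro a
    have h := hfix a
    rw [O.edgeRep_coboundary, ← sub_eq_zero, ← map_sub] at h
    have h1 := fun g => O.eq_of_coboundary_eq_zero hconn h g 1
    simp only [Pi.sub_apply, rightTranslation_inv_apply, one_mul] at h1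
    have h2 : ∑ g, (p (g * a) - p g) = 0 := by
      rw [Finset.sum_sub_distrib, sub_eq_zero]
      exact Equiv.sum_comp (Equiv.mulRight a) p
    rw [Finset.sum_congr rfl fun g _ => h1 g, Finset.sum_const, Finset.card_univ, nsmul_eq_mul,
      mul_eq_zero, sub_eq_zero] at h2
    exact h2.resolve_left (Nat.cast_ne_zero.2 Fintype.card_ne_zero)
  funext e
  rw [O.coboundary_apply, hconst, hconst (O.tail e), sub_self, Pi.zero_apply]

theorem not_isTrivial_of_injective_intertwiningMap [Finite Γ] (hgen : Subgroup.closure X = ⊤)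
    {𝕜 W : Type*} [Field 𝕜] [CharZero 𝕜] [AddCommGroup W] [Module 𝕜 W]
    (σ : Representation 𝕜 Γ W) (hirr : σ.IsIrreducible)
    (T : Representation.IntertwiningMap σ ((O.cutRep 𝕜).comp (rightTranslation X hinv hone)))
    (hT : Function.Injective T) : ¬ σ.IsTrivial := by
  intro htriv
  have hzero : ∀ w : W, w = 0 := by
    intro w
    apply hT
    rw [map_zero]
    apply Subtype.ext
    refine eq_zero_of_edgeRep_eq_self O hgen (T w).2 fun a => ?_
    have h : T (σ a w) = (O.cutRep 𝕜).comp (rightTranslation X hinv hone) a (T w) :=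
      LinearMap.congr_fun (T.isIntertwining' a) w
    rw [σ.isTrivial_apply] at h
    exact (congrArg Subtype.val h).symm
  obtain ⟨x, y, hxy⟩ := hirr.toNontrivial
  refine hxy (Subrepresentation.toSubmodule_injective ?_)
  ext w
  rw [hzero w]
  simp only [zero_mem]

/-- Not every cycle is fixed by the translations, because there is a cycle that avoids the vertex
`1`, whereas the translates of any cycle pass through every vertex. -/
theorem exists_edgeRep_ne_self
    (hG : (rightCayley X hinv hone).IsTwoInseparable) (h3 : 3 ≤ X.ncard) (𝕜 : Type*) [Field 𝕜] :
    ∃ z ∈ O.cycleSpace 𝕜, ∃ a, O.edgeRep 𝕜 (rightTranslation X hinv hone a) z ≠ z := by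
  have hfin : X.Finite := Set.finite_of_ncard_pos (by omega)
  obtain ⟨u, hu⟩ : X.Nonempty := Set.nonempty_of_ncard_ne_zero (by omega)
  have hu1 : u ≠ 1 := fun h => hone (h ▸ hu)
  -- Two neighbours of `u` different from `1`.
  obtain ⟨x, ⟨hx, hxu⟩, y, ⟨hy, hyu⟩, hxy⟩ :
      ∃ x ∈ X \ {u⁻¹}, ∃ y ∈ X \ {u⁻¹}, x ≠ y := by
    have h1 := Set.pred_ncard_le_ncard_sdiff_singleton X u⁻¹
    obtain ⟨x, y, hx, hy, hxy⟩ := (Set.one_lt_ncard_iff (s := X \ {u⁻¹})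
      (hfin.subset Set.sdiff_subset)).1 (by omega)
    exact ⟨x, hx, y, hy, hxy⟩
  have hne : ∀ t, t ∉ ({u⁻¹} : Set Γ) → t * u ≠ 1 := fun t ht h => ht (eq_inv_of_mul_eq_one_left h)
  have hadj : ∀ t ∈ X, (rightCayley X hinv hone).Adj u (t * u) := fun t ht => by
    rw [rightCayley_adj, mul_inv_cancel_right]
    exact ht
  obtain ⟨z, hz, hz1, hzu⟩ := O.exists_cycle 𝕜 hG hu1 (hadj x hx) (hadj y hy) (hne x hxu)
    (hne y hyu) (fun h => hxy (mul_right_cancel h))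
  refine ⟨z, hz, u, fun h => ?_⟩
  let e : (rightCayley X hinv hone).edgeSet := ⟨s(u, x * u), hadj x hx⟩
  have hze : z e ≠ 0 := (hzu e (by simp [e])).2 (Or.inl rfl)
  set φ := rightTranslation X hinv hone u with hφ
  refine hz1 (φ.mapEdgeSet e) ?_ ?_
  · rw [← h, O.edgeRep_apply, ← EdgeOrientation.mapEdgeSet_mul, inv_mul_cancel,
      EdgeOrientation.mapEdgeSet_one]
    refine mul_ne_zero ?_ hze
    unfold EdgeOrientation.sign
    split_ifs <;> simp
  · change 1 ∈ Sym2.map φ s(u, x * u)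
    rw [Sym2.map_mk, Sym2.mem_iff, hφ, rightTranslation_apply, mul_inv_cancel]
    exact Or.inl rfl

/-! ### Invariant projections -/

/-- In a 3-connected graphical regular representation, a linear map that commutes with the
translations commutes with all symmetries of the cycle space. -/
theorem commute_cyGroup [Finite Γ] (hgen : Subgroup.closure X = ⊤)
    (hG : (rightCayley X hinv hone).IsTwoInseparable) (h3 : 3 ≤ X.ncard)
    (hGRR : ∀ φ : rightCayley X hinv hone ≃g rightCayley X hinv hone,
      ∃ a : Γ, ∀ g : Γ, φ g = g * a)
    {L : ((rightCayley X hinv hone).edgeSet → ℝ) →ₗ[ℝ] ((rightCayley X hinv hone).edgeSet → ℝ)}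
    (hL : ∀ a f, L (O.edgeRep ℝ (rightTranslation X hinv hone a) f) =
      O.edgeRep ℝ (rightTranslation X hinv hone a) (L f)) :
    ∀ ω ∈ O.cyGroup, ∀ f, L (ω f) = ω (L f) := by
  intro ω hω f
  have hdeg : ∀ v w, ∃ a, a ≠ w ∧ (rightCayley X hinv hone).Adj v a := by
    intro v w
    obtain ⟨a, ha, haw⟩ := Set.exists_ne_of_one_lt_ncard
      (s := (rightCayley X hinv hone).neighborSet v)
      (by rw [ncard_neighborSet_rightCayley]; omega) w
    exact ⟨a, haw, ha⟩
  obtain ⟨φ, c, hc⟩ := EdgeOrientation.exists_eq_smul_edgeRep (rightCayley_preconnected hgen) hG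
    hdeg hω
  obtain ⟨a, ha⟩ := hGRR φ
  obtain rfl : φ = rightTranslation X hinv hone a⁻¹ := by
    ext g
    rw [ha, rightTranslation_apply, inv_inv]
  rw [hc, hc, map_smul, hL]

/-- Averaging a projection onto the cycle space over the group gives a projection that commutes
with the translations. -/
theorem exists_isProj_equivariant [Finite Γ] :
    ∃ P : ((rightCayley X hinv hone).edgeSet → ℝ) →ₗ[ℝ] ((rightCayley X hinv hone).edgeSet → ℝ),
      LinearMap.IsProj (O.cycleSpace ℝ) P ∧
      ∀ a f, P (O.edgeRep ℝ (rightTranslation X hinv hone a) f) =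
        O.edgeRep ℝ (rightTranslation X hinv hone a) (P f) := by
  cases nonempty_fintype Γ
  obtain ⟨q, hq⟩ := (O.cycleSpace ℝ).subtype.exists_leftInverse_of_injective
    (Submodule.ker_subtype _)
  let ρ : Representation ℝ Γ _ := (O.edgeRep ℝ).comp (rightTranslation X hinv hone)
  have hmem : ∀ a f, f ∈ O.cycleSpace ℝ → ρ a f ∈ O.cycleSpace ℝ :=
    fun a f hf => O.edgeRep_mem_cycleSpace ℝ _ hf
  let P := (Fintype.card Γ : ℝ)⁻¹ • ∑ g, ρ g ∘ₗ (O.cycleSpace ℝ).subtype ∘ₗ q ∘ₗ ρ g⁻¹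
  have hP : ∀ f, P f = (Fintype.card Γ : ℝ)⁻¹ • ∑ g, ρ g (q (ρ g⁻¹ f)) := fun f => by
    simp [P, LinearMap.sum_apply]
  refine ⟨P, ⟨fun f => ?_, fun f hf => ?_⟩, fun a f => ?_⟩
  · rw [hP]
    exact Submodule.smul_mem _ _ (Submodule.sum_mem _ fun g _ => hmem g _ (q _).2)
  · have h1 : ∀ g, ρ g (q (ρ g⁻¹ f)) = f := by
      intro g
      have h2 := LinearMap.congr_fun hq ⟨ρ g⁻¹ f, hmem _ _ hf⟩
      have h3 : (q (ρ g⁻¹ f) : _ → ℝ) = ρ g⁻¹ f := congrArg Subtype.val h2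
      rw [h3, Representation.self_inv_apply]
    rw [hP, Finset.sum_congr rfl fun g _ => h1 g, Finset.sum_const, Finset.card_univ,
      ← Nat.cast_smul_eq_nsmul ℝ, smul_smul,
      inv_mul_cancel₀ (Nat.cast_ne_zero.2 Fintype.card_ne_zero), one_smul]
  · change P (ρ a f) = ρ a (P f)
    rw [hP, hP, map_smul, map_sum, ← Equiv.sum_comp (Equiv.mulLeft a)]
    congr 1
    refine Finset.sum_congr rfl fun g _ => ?_
    rw [Equiv.coe_mulLeft, mul_inv_rev, map_mul, map_mul, Module.End.mul_apply,
      Module.End.mul_apply, Representation.inv_self_apply]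

/-- If some cycle `z` is not fixed by the translations, then `f ↦ ∑ g, (D f) g⁻¹ • (g • z)` is a
nonzero equivariant map to the cycle space which vanishes on the cycle space: it maps a unit flow
from `1` to `a⁻¹` to `a • z - z`. -/
theorem exists_equivariant_ne_zero [Finite Γ] (hgen : Subgroup.closure X = ⊤)
    {z : (rightCayley X hinv hone).edgeSet → ℝ} (hz : z ∈ O.cycleSpace ℝ) {a : Γ}
    (ha : O.edgeRep ℝ (rightTranslation X hinv hone a) z ≠ z) :
    ∃ T : ((rightCayley X hinv hone).edgeSet → ℝ) →ₗ[ℝ] ((rightCayley X hinv hone).edgeSet → ℝ),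
      T ≠ 0 ∧ (∀ f, T f ∈ O.cycleSpace ℝ) ∧ (∀ f ∈ O.cycleSpace ℝ, T f = 0) ∧
      ∀ a f, T (O.edgeRep ℝ (rightTranslation X hinv hone a) f) =
        O.edgeRep ℝ (rightTranslation X hinv hone a) (T f) := by
  classical
  cases nonempty_fintype Γ
  let ρ : Representation ℝ Γ _ := (O.edgeRep ℝ).comp (rightTranslation X hinv hone)
  let T := ∑ g, ((LinearMap.proj g⁻¹).comp (O.incidence ℝ).mulVecLin).smulRight (ρ g z)
  have hT : ∀ f, T f = ∑ g, (O.incidence ℝ *ᵥ f) g⁻¹ • ρ g z := fun f => by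
    simp [T, LinearMap.sum_apply]
  refine ⟨T, fun h => ha ?_, fun f => ?_, fun f hf => ?_, fun b f => ?_⟩
  · obtain ⟨f, hf, -⟩ := O.exists_flow ℝ (fun _ => True) (a := 1) (b := a⁻¹) trivial
      (Relation.ReflTransGen.mono (fun _ _ h => ⟨h, trivial⟩) _ _
        ((SimpleGraph.reachable_iff_reflTransGen _ _).1 (rightCayley_preconnected hgen _ _)))
    have h1 : T f = 0 := by rw [h, LinearMap.zero_apply]
    simp only [hT, hf, Pi.sub_apply, sub_smul, Finset.sum_sub_distrib, Pi.single_apply,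
      inv_inj, inv_eq_one, ite_smul, one_smul, zero_smul, Finset.sum_ite_eq', Finset.mem_univ,
      if_true, map_one, Module.End.one_apply, sub_eq_zero] at h1
    exact h1
  · rw [hT]
    exact Submodule.sum_mem _ fun g _ => Submodule.smul_mem _ _ (O.edgeRep_mem_cycleSpace ℝ _ hz)
  · rw [hT, O.mem_cycleSpace.1 hf]
    simp
  · change T (ρ b f) = ρ b (T f)
    rw [hT, hT, map_sum, ← Equiv.sum_comp (Equiv.mulLeft b)]
    refine Finset.sum_congr rfl fun g _ => ?_
    rw [map_smul, Equiv.coe_mulLeft, map_mul, Module.End.mul_apply]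
    change (O.incidence ℝ *ᵥ O.edgeRep ℝ (rightTranslation X hinv hone b) f) _ • _ = _
    rw [O.mulVec_edgeRep, rightTranslation_inv_apply, mul_inv_rev, inv_mul_cancel_right]

end CayleyRepresentation

open scoped Pointwise in
theorem mainTheorem11 {Γ : Type*} [Group Γ] [Finite Γ] (hcard : 2 < Nat.card Γ)
    (X : Set Γ) (hinv : X⁻¹ = X) (hone : (1 : Γ) ∉ X) (hgen : Subgroup.closure X = ⊤)
    (hGRR : ∀ φ : rightCayley X hinv hone ≃g rightCayley X hinv hone,
      ∃ a : Γ, ∀ g : Γ, φ g = g * a)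
    [Fintype (rightCayley X hinv hone).edgeSet]
    (O : EdgeOrientation (rightCayley X hinv hone)) :
    (∃ P Q : ((rightCayley X hinv hone).edgeSet → ℝ) →ₗ[ℝ]
          ((rightCayley X hinv hone).edgeSet → ℝ),
        O.IsInvariantProjection P ∧ O.IsInvariantProjection Q ∧ P ≠ Q) ∧
    (∀ (𝕜 : Type*) [RCLike 𝕜],
      (∀ (W : Type*) [AddCommGroup W] [Module 𝕜 W] (σ : Representation 𝕜 Γ W),
        σ.IsIrreducible →
          ((∃ T : Representation.IntertwiningMap σ
              ((O.cutRep 𝕜).comp (rightTranslation X hinv hone)), Function.Injective T) ↔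
            ¬ σ.IsTrivial)) ∧
      (∃ U : Subrepresentation ((O.cycleRep 𝕜).comp (rightTranslation X hinv hone)),
        Representation.IsIrreducible (V := U.toSubmodule) U.toRepresentation ∧
          ¬ U.toRepresentation.IsTrivial)) := by
  have h3 := three_le_ncard hcard hgen hGRR
  have hG : (rightCayley X hinv hone).IsTwoInseparable :=
    SimpleGraph.isTwoInseparable_of_vertexTransitive (rightCayley_preconnected hgen)
      rightCayley_vertexTransitive fun x => by rwa [ncard_neighborSet_rightCayley]
  refine ⟨?_, fun 𝕜 _ => ⟨fun W _ _ σ hσ => ⟨?_, ?_⟩, ?_⟩⟩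
  · obtain ⟨z, hz, a, ha⟩ := exists_edgeRep_ne_self O hG h3 ℝ
    obtain ⟨T, hT0, hTmem, hTzero, hT⟩ := exists_equivariant_ne_zero O hgen hz ha
    obtain ⟨P, hPproj, hP⟩ := exists_isProj_equivariant O
    refine ⟨P, P + T, ⟨hPproj, commute_cyGroup O hgen hG h3 hGRR hP⟩, ⟨⟨fun f => ?_, fun f hf => ?_⟩,
      commute_cyGroup O hgen hG h3 hGRR fun a f => ?_⟩, fun h => hT0 (left_eq_add.1 h)⟩
    · exact add_mem (hPproj.map_mem f) (hTmem f)
    · rw [LinearMap.add_apply, hPproj.map_id f hf, hTzero f hf, add_zero]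
    · rw [LinearMap.add_apply, LinearMap.add_apply, hP, hT, map_add]
  · rintro ⟨T, hT⟩
    exact not_isTrivial_of_injective_intertwiningMap O hgen σ hσ T hT
  · exact exists_injective_intertwiningMap_cutRep O hgen σ hσ
  · obtain ⟨z, hz, a, ha⟩ := exists_edgeRep_ne_self O hG h3 𝕜
    exact Representation.exists_isIrreducible_not_isTrivial
      ((O.cycleRep 𝕜).comp (rightTranslation X hinv hone)) (a := a) (v := ⟨z, hz⟩)
      fun h => ha (congrArg Subtype.val h)
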